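/- \textbf{Setting.} Let $X=\begin{pmatrix}1&0\\0&-1\end{pmatrix}$, $U=\begin{pmatrix}0&1\\0&0\end{pmatrix}$, $V=\begin{pmatrix}0&0\\1&0\end{pmatrix}$, $\Theta=U-V$, and fix $0<u_0<1$. Let $(\pi,\mathcal H)$ be one of the following unitary representations $(\pi_\nu^\pm,\mathcal H_\nu^\pm)$ of $SL(2,\mathbb R)$, with Casimir parameter $\mu=1-\nu^2$, set of weights $I$ and finite set $\mathcal S\subset I$: (i) principal series, $\nu\in i\mathbb R$: spherical, $I=2\mathbb Z$, $\mathcal S=\{0,2\}$, or non-spherical, $I=2\mathbb Z+1$, $\mathcal S=\{-1,1\}$; (ii) complementary series, $\nu\in(-u_0,u_0)\setminus\{0\}$: $I=2\mathbb Z$, $\mathcal S=\{0,2\}$; (iii) (mock) discrete series, $\nu=n\in\{0,1,2,\dots\}$: holomorphic, $I=\{n+1,n+3,\dots\}$, $\mathcal S=\{n+1\}$, or anti-holomorphic, $I=\{-n-1,-n-3,\dots\}$, $\mathcal S=\{-n-1\}$. These include, up to equivalence, every non-trivial irreducible unitary representation, apart from the complementary series with $|\nu|\ge u_0$. The space $\mathcal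 H$ has an orthogonal basis $(u_k)_{k\in I}$ with $\Theta u_k=ik\,u_k$ and $(X\pm i(U+V))u_k=(1+\nu\pm k)\,u_{k\pm2}$ (with $u_k=0$ for $k\notin I$), normalized by $\|u_k\|=1$ for those $k\in I$ with $|k|$ minimal. For $f=\sum_{k\in I}f_ku_k$ put $$\|f\|_s^2=\sum_{k\in I}(1+\mu+2k^2)^s\,|f_k|^2\,\|u_k\|^2,$$ let $\mathcal H^s$ ($s\ge0$) be the space of $f\in\mathcal H$ with $\|f\|_s<\infty$, let $\mathcal H^\infty=\bigcap_{s\ge 0}\mathcal H^s$, and let $\mathcal H^{-s}$ be the dual of $\mathcal H^s$. For $m\in\mathbb R$ let $\mathcal H^{-s}_{X-m}$ be the set of those $\mathcal D\in\mathcal H^{-s}$ with $(X-m)\mathcal D=0$ as a distribution, i.e. $\mathcal D((X+m)\varphi)=0$ for all $\varphi\in\mathcal H^\infty$. Put $g|_n=\sum_{k\in I,\,k\ge n}g_ku_k$ for $n>0$ and $g|_n=\sum_{k\in I,\,k\le n}g_ku_k$ for $n<0$; real powers of $\Theta$ act by $\Theta^a u_k=(ik)^a u_k$. \textbf{Theorem.}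 Let $0<u_0<1$ and $m\in\mathbb R\setminus\{0\}$. There is a constant $C_m>0$, depending only on $m$ and $u_0$, such that in each of the representations above there are $\mathcal D_n\in\mathcal H_{X-m}^{-\frac{|m|+8}{2}}$, $n\in\mathcal S$, with the following properties. (1) For every $s\ge\frac{|m|}{2}+8$ and $g\in\mathcal H^s$, the equation $$(X+m)f=g+\sum_{n\in\mathcal S}\mathcal D_n(g)\,u_n$$ has a solution $f\in\mathcal H^{s-\frac{|m|}{2}-3}$ such that, for all $0\le t\le s-\frac{|m|}{2}-3$, $$\|f\|_t\le C_m\|g\|_{t+\frac{|m|}{2}+3},$$ and, writing $f=\sum_{n\in I}f_nu_n$, for all $n\in I$ and all such $t$, $$\|f_nu_n\|_t\le C_m\big\|\Theta^{\frac{|m|+3}{2}}(g|_{n-2})\big\|_{t+\frac12}\ \text{ if } n<0,\qquad \|f_nu_n\|_t\le C_m\big\|\Theta^{\frac{|m|+3}{2}}(g|_{n+2})\big\|_{t+\frac12}\ \text{ if } n>0.$$ (2) For every $s\ge\frac{|m|}{2}+8$ and $g\in\mathcal H^s$: if $(X+m)f=g$ has a solution $f\in\mathcal H^{\frac{|m|+10}{2}}$,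 then $\mathcal D_n(g)=0$ for all $n\in\mathcal S$. (3) For every $s\ge\frac{|m|+8}{2}$, $g\in\mathcal H^s$, $n\in\mathcal S$ and $0\le t\le s-\frac{|m|+8}{2}$, $$\|\mathcal D_n(g)u_n\|_t\le C_m\|g\|_{t+\frac{|m|+8}{2}}.$$ -/

import Mathlib

open scoped InnerProductSpace MatrixGroups

namespace TwistedSL2

noncomputable section

/-- A strongly continuous unitary representation of `SL(2, ℝ)` on a complex Hilbert space. -/
structure UnitaryRep (H : Type*) [NormedAddCommGroup H] [InnerProductSpace ℂ H] where
  toHom : SL(2, ℝ) →* (H ≃ₗᵢ[ℂ] H)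
  continuous_orbit : ∀ v : H, Continuous fun g => toHom g v

/-- The geodesic one-parameter group `exp (t X)`, where `X = !![1, 0; 0, -1]`. -/
def expX (t : ℝ) : SL(2, ℝ) :=
  ⟨!![Real.exp t, 0; 0, Real.exp (-t)], by simp [Matrix.det_fin_two, ← Real.exp_add]⟩

/-- The unipotent one-parameter group `exp (t U)`, where `U = !![0, 1; 0, 0]`. -/
def expU (t : ℝ) : SL(2, ℝ) := ⟨!![1, t; 0, 1], by simp [Matrix.det_fin_two]⟩

/-- The unipotent one-parameter group `exp (t V)`, where `V = !![0, 0; 1, 0]`. -/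
def expV (t : ℝ) : SL(2, ℝ) := ⟨!![1, 0; t, 1], by simp [Matrix.det_fin_two]⟩

/-- `Derives π γ v w`: the vector `v` lies in the domain of the infinitesimal generator of the
one-parameter unitary group `t ↦ π (γ t)`, and the generator maps `v` to `w`. -/
def Derives {H : Type*} [NormedAddCommGroup H] [InnerProductSpace ℂ H]
    (π : UnitaryRep H) (γ : ℝ → SL(2, ℝ)) (v w : H) : Prop :=
  HasDerivAt (fun t : ℝ => π.toHom (γ t) v) w 0

/-- The twisted cohomological equation `(X + m) f = g`. -/
def SolvesTwisted {H : Type*} [NormedAddCommGroup H] [InnerProductSpace ℂ H]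
    (π : UnitaryRep H) (m : ℝ) (f g : H) : Prop :=
  ∃ w : H, Derives π expX f w ∧ w + (m : ℂ) • f = g

/-- The labels of the non-trivial irreducible unitary representations `H_ν^±` of `SL(2, ℝ)`.
* `principalEven r`, `principalOdd r`: spherical and non-spherical principal series, `ν = i r`;
* `complementary ν`: complementary series;
* `holomorphic n`, `antiholomorphic n`: the discrete series with `|ν| = n`, of lowest weight `n + 1`
  and of highest weight `-(n + 1)` (mock discrete series when `n = 0`). -/
inductive Series where
  | principalEven (r : ℝ)
  | principalOdd (r : ℝ)
  | complementary (ν : ℝ)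
  | holomorphic (n : ℕ)
  | antiholomorphic (n : ℕ)

namespace Series

/-- The representation parameter `ν`, a square root of `1 - μ`. The two discrete series with the
same Casimir parameter are mirror images `u_k ↔ u_{-k}` of each other, and the formulas below use
the nonnegative root for both. -/
def nu : Series → ℂ
  | principalEven r => Complex.I * r
  | principalOdd r => Complex.I * r
  | complementary ν => ν
  | holomorphic n => n
  | antiholomorphic n => n

/-- The Casimir parameter `μ = 1 - ν²`. -/
def mu : Series → ℝ
  | principalEven r => 1 + r ^ 2
  | principalOdd r => 1 + r ^ 2
  | complementary ν => 1 - ν ^ 2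
  | holomorphic n => 1 - (n : ℝ) ^ 2
  | antiholomorphic n => 1 - (n : ℝ) ^ 2

/-- The set `I_ν` of weights. -/
def weights : Series → Set ℤ
  | principalEven _ => {k | Even k}
  | principalOdd _ => {k | Odd k}
  | complementary _ => {k | Even k}
  | holomorphic n => {k | (n : ℤ) + 1 ≤ k ∧ Even (k - (n + 1))}
  | antiholomorphic n => {k | k ≤ -((n : ℤ) + 1) ∧ Even (k - (n + 1))}

/-- The finite set `S_ν^±` that indexes the invariant distributions. -/
def obstructions : Series → Finset ℤ
  | principalEven _ => {0, 2}
  | principalOdd _ => {-1, 1}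
  | complementary _ => {0, 2}
  | holomorphic n => {(n : ℤ) + 1}
  | antiholomorphic n => {-((n : ℤ) + 1)}

/-- The spectral gap: complementary series only occur with `0 < |ν| < u₀`. -/
def HasGap (u₀ : ℝ) : Series → Prop
  | complementary ν => ν ≠ 0 ∧ |ν| < u₀
  | _ => True

end Series

/-- `IsAdaptedBasis π P u`: the unitary representation `π` is the model `(π_ν^±, H_ν^±)` with label
`P`, and `u` is its adapted orthogonal basis `{u_k}`, `k ∈ I_ν`, extended by zero to all integers.
The basis consists of eigenvectors of `Θ = U - V`, the raising and lowering operators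
`X ± i (U + V)` act by `u_k ↦ (1 + ν ± k) u_{k ± 2}`, and the vectors with `|k|` minimal are
normalized. (That `π` is unitary then forces
`‖u_k‖² = (|k| - 1 - ν) / (|k| - 1 + ν) ‖u_{k-2}‖²` for `k > 0` and real `ν`, its mirror image for
`k < 0`, and `‖u_k‖ = 1` for imaginary `ν`.) -/
structure IsAdaptedBasis {H : Type*} [NormedAddCommGroup H] [InnerProductSpace ℂ H]
    (π : UnitaryRep H) (P : Series) (u : ℤ → H) : Prop where
  eq_zero : ∀ k, k ∉ P.weights → u k = 0
  orthogonal : ∀ j k, j ≠ k → ⟪u j, u k⟫_ℂ = 0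
  total : (Submodule.span ℂ (Set.range u)).topologicalClosure = ⊤
  normalized : ∀ k ∈ P.weights, (∀ j ∈ P.weights, |k| ≤ |j|) → ‖u k‖ = 1
  action : ∀ k ∈ P.weights, ∃ x y z : H,
    Derives π expX (u k) x ∧ Derives π expU (u k) y ∧ Derives π expV (u k) z ∧
      y - z = (Complex.I * k) • u k ∧
      x + Complex.I • (y + z) = (1 + P.nu + k) • u (k + 2) ∧
      x - Complex.I • (y + z) = (1 + P.nu - k) • u (k - 2)

section Sobolev

variable {H : Type*} [NormedAddCommGroup H] [InnerProductSpace ℂ H]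

/-- The Fourier coefficients `v_k` of `v = ∑ v_k u_k`. -/
def coeff (u : ℤ → H) (v : H) (k : ℤ) : ℂ := ⟪u k, v⟫_ℂ / (‖u k‖ : ℂ) ^ 2

/-- The `k`-th summand of the squared Sobolev norm of order `s` of the series `∑ c_k u_k`. -/
def sobolevTerm (P : Series) (u : ℤ → H) (s : ℝ) (c : ℤ → ℂ) (k : ℤ) : ℝ :=
  (1 + P.mu + 2 * (k : ℝ) ^ 2) ^ s * ‖u k‖ ^ 2 * ‖c k‖ ^ 2

/-- The Sobolev norm of order `s` of the (formal) Fourier series `∑ c_k u_k`. -/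
def seriesNorm (P : Series) (u : ℤ → H) (s : ℝ) (c : ℤ → ℂ) : ℝ :=
  Real.sqrt (∑' k : ℤ, sobolevTerm P u s c k)

/-- The Sobolev norm `‖v‖_s`. -/
def sobolevNorm (P : Series) (u : ℤ → H) (s : ℝ) (v : H) : ℝ := seriesNorm P u s (coeff u v)

/-- The Sobolev space `H^s`, for `s ≥ 0`. (Outside `I_ν` the summands vanish, as `u_k = 0`; the
absolute value only serves to make the definition sensible before this is known.) -/
def sobolev (P : Series) (u : ℤ → H) (s : ℝ) : Submodule ℂ H where
  carrier := {v | Summable fun k => |sobolevTerm P u s (coeff u v) k|}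
  zero_mem' := by
    have h : (fun k => |sobolevTerm P u s (coeff u (0 : H)) k|) = fun _ => 0 := by
      funext k; simp [sobolevTerm, coeff]
    change Summable _
    rw [h]
    exact summable_zero
  add_mem' := by
    intro v w hv hw
    refine Summable.of_nonneg_of_le (fun _ => abs_nonneg _) (fun k => ?_)
      ((hv.mul_left 2).add (hw.mul_left 2))
    have hc : coeff u (v + w) k = coeff u v k + coeff u w k := by
      simp [coeff, add_div]
    have h1 := norm_add_le (coeff u v k) (coeff u w k)
    have h2 : ‖coeff u v k + coeff u w k‖ ^ 2 ≤ 2 * ‖coeff u v k‖ ^ 2 + 2 * ‖coeff u w k‖ ^ 2 := by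
      nlinarith [norm_nonneg (coeff u v k + coeff u w k), norm_nonneg (coeff u v k),
        norm_nonneg (coeff u w k), sq_nonneg (‖coeff u v k‖ - ‖coeff u w k‖)]
    simp only [sobolevTerm, hc, abs_mul, abs_pow, abs_norm]
    have h3 : 0 ≤ |(1 + P.mu + 2 * (k : ℝ) ^ 2) ^ s| * ‖u k‖ ^ 2 := by positivity
    nlinarith [mul_le_mul_of_nonneg_left h2 h3]
  smul_mem' := by
    intro a v hv
    refine (hv.mul_left (‖a‖ ^ 2)).congr (fun k => ?_)
    have hc : coeff u (a • v) k = a * coeff u v k := by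
      simp [coeff, mul_div_assoc]
    simp only [sobolevTerm, hc, abs_mul, abs_pow, abs_norm, norm_mul]
    ring

/-- `D ∈ (H_ν^±)_{X-m}^{-s}`: the linear functional `D` on `H^s` is bounded, and `(X - m) D = 0`
as a distribution. Since `(X D)(φ) = -D (X φ)`, this means that `D` kills `(X + m) φ` for all
`φ` in the space `H^∞` of smooth vectors, the intersection of all `H^r`. -/
def IsInvariantDistribution (π : UnitaryRep H) (P : Series) (u : ℤ → H) (m s : ℝ)
    (D : sobolev P u s →ₗ[ℂ] ℂ) : Prop :=
  (∃ K : ℝ, ∀ g : sobolev P u s, ‖D g‖ ≤ K * sobolevNorm P u s g) ∧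
    ∀ φ : H, (∀ r : ℝ, 0 ≤ r → φ ∈ sobolev P u r) →
      ∀ h : sobolev P u s, SolvesTwisted π m φ h → D h = 0

end Sobolev

/-- The tail `c|_n` of a Fourier series, for `n ≠ 0`. -/
def tail (n : ℤ) (c : ℤ → ℂ) (k : ℤ) : ℂ :=
  if (0 < n ∧ n ≤ k) ∨ (n < 0 ∧ k ≤ n) then c k else 0

/-- The power `Θ^a` of `Θ = U - V`, acting on Fourier series; recall `Θ u_k = i k u_k`. -/
def thetaPow (a : ℝ) (c : ℤ → ℂ) (k : ℤ) : ℂ := (Complex.I * k) ^ (a : ℂ) * c k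

end

end TwistedSL2

open TwistedSL2

/-! ### Green's functions of half-line Jacobi operators and their growth -/

namespace TwistedSL2

open scoped ComplexConjugate

/-! In the normalized basis `v_k = u_k / ‖u_k‖`, skew-symmetry of `X` gives `2 X v_k = A_k v_{k+2} -
conj A_{k-2} v_{k-2}` with `|A_k|² = (k + 1)² - ν²`. Hence `(X + m) f = g` is the three-term
recurrence `A_{k-2} F_{k-2} + 2 m F_k - conj (A_k) F_{k+2} = 2 y_k` for the coordinates `F` of `f`
and `y` of `g`. It is solved from infinity: for `j > 0` the coordinate `F_j` is a sum of the
`y_{j+2i}`, `i ≥ 1`, against Green's function with pole at `j`; for `j ≤ 0` the sum runs over the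
`y_{j-2i}`. The downward half-line is the same problem with coefficients `-conj (A_{j-2i-2})`, so
one operator serves both sides.

Green's function also solves the recurrence in its pole (`green_shift`), so this `F` satisfies the
equation at `n` whenever one half-line contains `n - 2`, `n` and `n + 2`. It can fail only where the
two half-lines meet or at an extremal weight, which are exactly the points of `𝒮`. The distribution
`D_n` is the residual there, divided by `‖u_n‖`; adding `D_n(g) u_n` to `g` repairs the equation.
Conversely, summation by parts against Green's function shows that every sufficiently regular
solution has the coordinates `F` (`GapModel.solution_eq`), so its residuals vanish. This gives both
the necessity of `D_n(g) = 0` and the invariance of `D_n`.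

All estimates rest on the bound `|G_i| ≤ K i^(|m|/2 + 1)` of `norm_green_le`, which uses only that
`|a_i|` is nondecreasing and at least `2 i + δ`. Since `δ = 1 - u₀` works in all the series at once,
the constants do not depend on the representation. Cauchy-Schwarz then bounds one coordinate of `F`
with a loss of `|m|/2 + 2` derivatives. One more derivative buys summability over the weights, or
pays for the ladder coefficients in the residual. -/

/-- Green's function of the half-line Jacobi operator
`(T b) i = (a (i - 1) b (i - 1) + 2 m b i - conj (a i) b (i + 1)) / 2`, with pole at `0`. -/
noncomputable def green (m : ℝ) (a : ℕ → ℂ) : ℕ → ℂ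
  | 0 => 0
  | 1 => 2 / a 0
  | (i + 2) => (-2 * m * green m a (i + 1) + conj (a i) * green m a i) / a (i + 1)

section Green

variable {m : ℝ} {a : ℕ → ℂ}

lemma green_zero : green m a 0 = 0 := by rw [green]

lemma green_one : green m a 1 = 2 / a 0 := by rw [green]

lemma mul_green_add_two (ha : ∀ i, a i ≠ 0) (i : ℕ) :
    a (i + 1) * green m a (i + 2) = -2 * m * green m a (i + 1) + conj (a i) * green m a i := by
  rw [green, mul_div_cancel₀ _ (ha _)]

/-- This is the recurrence in the pole instead of the position. As a function of `i`, the left-hand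
side obeys the same two-step recurrence as the three Green's functions, whose coefficients agree
after the shifts, and it vanishes at the first two values. -/
lemma green_shift (ha : ∀ i, a i ≠ 0) (i : ℕ) :
    a 0 * green m a (i + 2) + 2 * m * green m (fun l => a (l + 1)) (i + 1)
      - conj (a 1) * green m (fun l => a (l + 2)) i = 0 := by
  induction i using Nat.twoStepInduction with
  | zero =>
    have h0 := ha 0
    have h1 := ha 1
    simp only [green, zero_add]
    field_simp
    ring
  | one =>
    have h0 := ha 0
    have h1 := ha 1
    have h2 := ha 2
    simp only [green, zero_add, Nat.reduceAdd]
    field_simp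
    ring
  | more i h1 h2 =>
    have e1 := mul_green_add_two (m := m) ha (i + 2)
    have e2 := mul_green_add_two (m := m) (a := fun l => a (l + 1)) (fun l => ha _) (i + 1)
    have e3 := mul_green_add_two (m := m) (a := fun l => a (l + 2)) (fun l => ha _) i
    simp only [add_assoc, Nat.reduceAdd] at e1 e2 e3 h1 h2 ⊢
    refine (mul_eq_zero.1 ?_).resolve_left (ha (i + 3))
    linear_combination a 0 * e1 + 2 * m * e2 - conj (a 1) * e3 - 2 * m * h2 + conj (a (i + 2)) * h1

/-- Summation by parts against Green's function. -/
lemma sum_green_mul (ha : ∀ i, a i ≠ 0) {b h : ℕ → ℂ}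
    (hb : ∀ i, a i * b i + 2 * m * b (i + 1) - conj (a (i + 1)) * b (i + 2) = 2 * h (i + 1))
    (n : ℕ) :
    2 * ∑ i ∈ Finset.range (n + 1), green m a i * h i =
      2 * b 0 - a n * green m a (n + 1) * b n - conj (a n) * green m a n * b (n + 1) := by
  induction n with
  | zero =>
    simp only [zero_add, Finset.sum_range_one, green_zero, green_one]
    rw [mul_div_cancel₀ _ (ha 0)]
    ring
  | succ n ih =>
    rw [Finset.sum_range_succ, mul_add, ih]
    linear_combination -green m a (n + 1) * hb n + b (n + 1) * mul_green_add_two (m := m) ha n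

/-- The growth constant of Green's function. -/
noncomputable def greenConst (m δ : ℝ) : ℝ := 2 / δ * (|m| + 1) ^ (⌈|m| * (|m| + 2) / 8⌉₊ + 2)

lemma greenConst_pos (m : ℝ) {δ : ℝ} (hδ : 0 < δ) : 0 < greenConst m δ := by
  unfold greenConst; positivity

/-- Powers dominate the recurrence of `green` far out. With `B ≤ A` and `A ≈ 2 x`, the leading-order
balance requires an exponent of at least `M / 2`; the additional `1` gives the slack that absorbs
lower-order terms. Bernoulli's inequality compares the three consecutive powers. -/
lemma rpow_supersolution {M A B x : ℝ} (hM : 0 ≤ M) (hx : 1 ≤ x) (hxM : M * (M + 2) / 8 ≤ x)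
    (hA : 2 * (x + 1) ≤ A) (hBA : B ≤ A) :
    2 * M * (x + 1) ^ (M / 2 + 1) + B * x ^ (M / 2 + 1) ≤ A * (x + 2) ^ (M / 2 + 1) := by
  set p := M / 2 + 1 with hp
  have hp1 : 1 ≤ p := by linarith
  have hx0 : 0 < x := by linarith
  set S := (x + 1) ^ p with hS
  have hS0 : 0 < S := by positivity
  have h1 : S * (1 + p / (x + 1)) ≤ (x + 2) ^ p := by
    have hb := one_add_mul_self_le_rpow_one_add (s := 1 / (x + 1))
      (by have : 0 < 1 / (x + 1) := by positivity
          linarith) hp1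
    have e : (x + 2) ^ p = S * (1 + 1 / (x + 1)) ^ p := by
      rw [hS, ← Real.mul_rpow (by positivity) (by positivity)]
      congr 1; field_simp; ring
    rw [e]
    refine mul_le_mul_of_nonneg_left ?_ hS0.le
    calc 1 + p / (x + 1) = 1 + p * (1 / (x + 1)) := by ring
      _ ≤ _ := hb
  have h2 : x ^ p * (1 + p / x) ≤ S := by
    have hb := one_add_mul_self_le_rpow_one_add (s := 1 / x)
      (by have : 0 < 1 / x := by positivity
          linarith) hp1
    have e : S = x ^ p * (1 + 1 / x) ^ p := by
      rw [hS, ← Real.mul_rpow (by positivity) (by positivity)]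
      congr 1; field_simp
    rw [e]
    refine mul_le_mul_of_nonneg_left ?_ (by positivity)
    calc 1 + p / x = 1 + p * (1 / x) := by ring
      _ ≤ _ := hb
  have h3 : x ^ p ≤ S * (x / (x + p)) := by
    have e : x ^ p = x ^ p * (1 + p / x) * (x / (x + p)) := by field_simp
    rw [e]
    exact mul_le_mul_of_nonneg_right h2 (by positivity)
  have hA0 : 0 ≤ A := by linarith
  have h4 : 2 * M ≤ A * (p / (x + 1) + p / (x + p)) := by
    have h5 : 2 * M ≤ 2 * (x + 1) * (p / (x + 1) + p / (x + p)) := by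
      have e : 2 * (x + 1) * (p / (x + 1) + p / (x + p)) = 2 * p + 2 * p * (x + 1) / (x + p) := by
        field_simp
      -- After clearing denominators this is `M² / 2 ≤ 4 x + M + 4`, which the threshold `M (M + 2)
      -- / 8 ≤ x` ensures.
      rw [e, ← sub_le_iff_le_add', le_div_iff₀ (by positivity), hp]
      nlinarith
    exact h5.trans (mul_le_mul_of_nonneg_right hA (by positivity))
  have h6 : x / (x + p) = 1 - p / (x + p) := by field_simp; ring
  calc 2 * M * S + B * x ^ p ≤ 2 * M * S + A * (S * (x / (x + p))) := by
        gcongr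
    _ ≤ A * (p / (x + 1) + p / (x + p)) * S + A * (S * (x / (x + p))) := by gcongr
    _ = A * (S * (1 + p / (x + 1))) := by rw [h6]; ring
    _ ≤ A * (x + 2) ^ p := by gcongr

/-- Only a lower bound and monotonicity of `‖a i‖` enter, so the estimate is uniform over all
representations with the gap. -/
lemma norm_green_le {δ : ℝ} (hδ : 0 < δ) (ha : ∀ i : ℕ, 2 * i + δ ≤ ‖a i‖)
    (hmono : ∀ i, ‖a i‖ ≤ ‖a (i + 1)‖) (i : ℕ) :
    ‖green m a i‖ ≤ greenConst m δ * (i : ℝ) ^ (|m| / 2 + 1) := by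
  set Q := ⌈|m| * (|m| + 2) / 8⌉₊ + 2 with hQ
  set p := |m| / 2 + 1 with hp
  have hm0 := abs_nonneg m
  have hp0 : 0 < p := by positivity
  have hΛ : 1 ≤ |m| + 1 := by linarith
  -- Up to the index `Q` each step costs a factor `|m| + 1`; beyond it the power is a supersolution
  -- and the constant no longer grows. The exponent `min i Q` records this.
  have key : ∀ i : ℕ, ‖green m a i‖ ≤ 2 / δ * (|m| + 1) ^ min i Q * (i : ℝ) ^ p := by
    intro i
    induction i using Nat.twoStepInduction with
    | zero => simp [green_zero, Real.zero_rpow hp0.ne']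
    | one =>
      have h0 := ha 0
      simp only [Nat.cast_zero, mul_zero, zero_add] at h0
      rw [green_one, norm_div, Nat.cast_one, Real.one_rpow, mul_one]
      have h1 : ‖(2 : ℂ)‖ / ‖a 0‖ ≤ 2 / δ := by
        rw [Complex.norm_ofNat]
        gcongr
      refine h1.trans (le_mul_of_one_le_right (by positivity) (one_le_pow₀ hΛ))
    | more i h1 h2 =>
      have hai := ha (i + 1)
      push_cast at hai
      have hA : 2 * ((i : ℝ) + 1) ≤ ‖a (i + 1)‖ := by linarith
      have hA0 : 0 < ‖a (i + 1)‖ := lt_of_lt_of_le (by positivity) hA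
      have e : ‖a (i + 1)‖ * ‖green m a (i + 2)‖ ≤
          2 * |m| * ‖green m a (i + 1)‖ + ‖a i‖ * ‖green m a i‖ := by
        have hne : a (i + 1) ≠ 0 := norm_pos_iff.1 hA0
        rw [← norm_mul, green, mul_div_cancel₀ _ hne]
        refine (norm_add_le _ _).trans (le_of_eq ?_)
        simp
      rw [← mul_le_mul_iff_right₀ hA0]
      refine e.trans ?_
      push_cast at h1 h2 ⊢
      rcases lt_or_ge (i + 1) Q with hi | hi
      · have e1 : min i Q = i := by omega
        have e2 : min (i + 1) Q = i + 1 := by omega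
        have e3 : min (i + 2) Q = i + 2 := by omega
        rw [e1] at h1
        rw [e2] at h2
        rw [e3]
        set T := 2 / δ * (|m| + 1) ^ (i + 1) * ((i : ℝ) + 2) ^ p with hT
        have hT0 : 0 ≤ T := by positivity
        have g1 : ‖green m a i‖ ≤ T := by
          refine h1.trans ?_
          rw [hT]
          gcongr
          · omega
          · linarith
        have g2 : ‖green m a (i + 1)‖ ≤ T := by
          refine h2.trans ?_
          rw [hT]
          gcongr
          linarith
        have e4 : 2 / δ * (|m| + 1) ^ (i + 2) * ((i : ℝ) + 2) ^ p = (|m| + 1) * T := by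
          rw [hT]; ring
        rw [e4]
        have h3 : 2 * |m| ≤ ‖a (i + 1)‖ * |m| := by
          have : (0 : ℝ) ≤ i := by positivity
          exact mul_le_mul_of_nonneg_right (by linarith) hm0
        calc 2 * |m| * ‖green m a (i + 1)‖ + ‖a i‖ * ‖green m a i‖
            ≤ ‖a (i + 1)‖ * |m| * T + ‖a (i + 1)‖ * T := by
              gcongr
              exact hmono i
          _ = _ := by ring
      · have e2 : min (i + 1) Q = Q := by omega
        have e3 : min (i + 2) Q = Q := by omega
        rw [e2] at h2
        rw [e3]
        have g1 : ‖green m a i‖ ≤ 2 / δ * (|m| + 1) ^ Q * (i : ℝ) ^ p := by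
          refine h1.trans ?_
          gcongr
          exact min_le_right _ _
        set T := 2 / δ * (|m| + 1) ^ Q with hT
        have hT0 : 0 ≤ T := by positivity
        have hi1 : ⌈|m| * (|m| + 2) / 8⌉₊ + 1 ≤ i := by omega
        have hs := rpow_supersolution (x := i) hm0 (by exact_mod_cast (by omega : 1 ≤ i))
          ((Nat.le_ceil _).trans (by exact_mod_cast (by omega))) hA (hmono i)
        calc 2 * |m| * ‖green m a (i + 1)‖ + ‖a i‖ * ‖green m a i‖
            ≤ 2 * |m| * (T * ((i : ℝ) + 1) ^ p) + ‖a i‖ * (T * (i : ℝ) ^ p) := by gcongr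
          _ = T * (2 * |m| * ((i : ℝ) + 1) ^ p + ‖a i‖ * (i : ℝ) ^ p) := by ring
          _ ≤ T * (‖a (i + 1)‖ * ((i : ℝ) + 2) ^ p) := by gcongr
          _ = _ := by ring
  refine (key i).trans ?_
  unfold greenConst
  gcongr
  exact min_le_right _ _

/-! ### Sums against Green's function -/

/-- Cauchy-Schwarz for infinite sums. -/
lemma summable_mul_and_sq_tsum_le {ι : Type*} {x y : ι → ℝ} (hx : Summable fun i => x i ^ 2)
    (hy : Summable fun i => y i ^ 2) (hx0 : ∀ i, 0 ≤ x i) (hy0 : ∀ i, 0 ≤ y i) :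
    (Summable fun i => x i * y i) ∧
      (∑' i, x i * y i) ^ 2 ≤ (∑' i, x i ^ 2) * ∑' i, y i ^ 2 := by
  have hs : Summable fun i => x i * y i :=
    Summable.of_nonneg_of_le (fun i => mul_nonneg (hx0 i) (hy0 i))
      (fun i => by nlinarith [sq_nonneg (x i - y i)]) (hx.add hy)
  refine ⟨hs, le_of_tendsto (hs.hasSum.pow 2) (Filter.Eventually.of_forall fun s => ?_)⟩
  refine (Finset.sum_mul_sq_le_sq_mul_sq s x y).trans ?_
  exact mul_le_mul (hx.sum_le_tsum s fun i _ => sq_nonneg _)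
    (hy.sum_le_tsum s fun i _ => sq_nonneg _) (Finset.sum_nonneg fun i _ => sq_nonneg _)
    (tsum_nonneg fun i => sq_nonneg _)

/-- The constant in the weighted bound for sums against Green's function. -/
noncomputable def greenSumConst (m δ : ℝ) : ℝ :=
  (∑' i : ℕ, 1 / (i : ℝ) ^ 2) * greenConst m δ ^ 2

lemma greenSumConst_nonneg (m δ : ℝ) : 0 ≤ greenSumConst m δ :=
  mul_nonneg (tsum_nonneg fun _ => by positivity) (sq_nonneg _)

/-- Cauchy-Schwarz for the factors `1 / i` and `i ‖G_i‖ ‖h_i‖`. In the application `κ` is `|k|`,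
which becomes the power of `Θ`, and `W` is the Sobolev weight. -/
lemma tsum_green_mul_bound {δ : ℝ} (hδ : 0 < δ) (ha : ∀ i : ℕ, 2 * i + δ ≤ ‖a i‖)
    (hmono : ∀ i, ‖a i‖ ≤ ‖a (i + 1)‖) {h : ℕ → ℂ} {κ W : ℕ → ℝ} (hκ : ∀ i : ℕ, (i : ℝ) ≤ κ i)
    (hW : ∀ i : ℕ, (i : ℝ) ^ 2 ≤ W i)
    (hs : Summable fun i => κ i ^ (|m| + 3) * W i ^ (1 / 2 : ℝ) * ‖h i‖ ^ 2) :
    (Summable fun i => green m a i * h i) ∧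
      ‖∑' i, green m a i * h i‖ ^ 2 ≤
        greenSumConst m δ * ∑' i, κ i ^ (|m| + 3) * W i ^ (1 / 2 : ℝ) * ‖h i‖ ^ 2 := by
  have hG := norm_green_le (m := m) hδ ha hmono
  have hK := (greenConst_pos m hδ).le
  have hm0 := abs_nonneg m
  have hx : Summable fun i : ℕ => (1 / (i : ℝ)) ^ 2 := by
    simpa only [one_div, inv_pow] using Real.summable_nat_pow_inv.2 one_lt_two
  have hle : ∀ i : ℕ, ((i : ℝ) * (‖green m a i‖ * ‖h i‖)) ^ 2 ≤
      greenConst m δ ^ 2 * (κ i ^ (|m| + 3) * W i ^ (1 / 2 : ℝ) * ‖h i‖ ^ 2) := by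
    intro i
    have hκ0 : 0 ≤ κ i := (Nat.cast_nonneg i).trans (hκ i)
    have hW0 : 0 ≤ W i := (sq_nonneg _).trans (hW i)
    rcases Nat.eq_zero_or_pos i with rfl | hi
    · refine (le_of_eq ?_).trans (show 0 ≤ _ by positivity)
      simp
    · have hi0 : (0 : ℝ) < i := by exact_mod_cast hi
      have h1 : (i : ℝ) ^ (|m| + 3) ≤ κ i ^ (|m| + 3) := by
        gcongr
        exact hκ i
      have h2 : (i : ℝ) ≤ W i ^ (1 / 2 : ℝ) := by
        rw [← Real.sqrt_eq_rpow]
        exact Real.le_sqrt_of_sq_le (hW i)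
      -- Of the `|m| + 4` powers of `i`, the amount `|m| + 3` is charged to `κ` and the last one to
      -- `W ^ (1 / 2)`.
      have h3 : (i : ℝ) ^ 2 * ((i : ℝ) ^ (|m| / 2 + 1)) ^ 2 = (i : ℝ) ^ (|m| + 3) * i := by
        rw [← Real.rpow_natCast (n := 2), ← Real.rpow_natCast (n := 2), ← Real.rpow_mul hi0.le,
          ← Real.rpow_add hi0, ← Real.rpow_add_one hi0.ne']
        congr 1
        push_cast
        ring
      have h4 : ‖green m a i‖ ^ 2 ≤ (greenConst m δ * (i : ℝ) ^ (|m| / 2 + 1)) ^ 2 :=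
        pow_le_pow_left₀ (norm_nonneg _) (hG i) 2
      calc ((i : ℝ) * (‖green m a i‖ * ‖h i‖)) ^ 2
          = (i : ℝ) ^ 2 * ‖green m a i‖ ^ 2 * ‖h i‖ ^ 2 := by ring
        _ ≤ (i : ℝ) ^ 2 * (greenConst m δ * (i : ℝ) ^ (|m| / 2 + 1)) ^ 2 * ‖h i‖ ^ 2 := by gcongr
        _ = greenConst m δ ^ 2 * ((i : ℝ) ^ 2 * ((i : ℝ) ^ (|m| / 2 + 1)) ^ 2 * ‖h i‖ ^ 2) := by
            ring
        _ ≤ _ := by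
            rw [h3]
            gcongr
  have hy : Summable fun i : ℕ => ((i : ℝ) * (‖green m a i‖ * ‖h i‖)) ^ 2 :=
    Summable.of_nonneg_of_le (fun _ => sq_nonneg _) hle (hs.mul_left _)
  obtain ⟨h1, h2⟩ := summable_mul_and_sq_tsum_le hx hy (fun _ => by positivity)
    (fun _ => by positivity)
  have he : (fun i : ℕ => 1 / (i : ℝ) * ((i : ℝ) * (‖green m a i‖ * ‖h i‖))) =
      fun i => ‖green m a i * h i‖ := by
    funext i
    rw [norm_mul]
    rcases Nat.eq_zero_or_pos i with rfl | hi
    · simp [green_zero]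
    · have hi0 : (i : ℝ) ≠ 0 := by positivity
      field_simp
  rw [he] at h1 h2
  refine ⟨h1.of_norm, ?_⟩
  calc ‖∑' i, green m a i * h i‖ ^ 2 ≤ (∑' i, ‖green m a i * h i‖) ^ 2 :=
        pow_le_pow_left₀ (norm_nonneg _) (norm_tsum_le_tsum_norm h1) 2
    _ ≤ _ := h2
    _ ≤ (∑' i : ℕ, (1 / (i : ℝ)) ^ 2) *
        ∑' i, greenConst m δ ^ 2 * (κ i ^ (|m| + 3) * W i ^ (1 / 2 : ℝ) * ‖h i‖ ^ 2) := by
        refine mul_le_mul_of_nonneg_left (hy.tsum_le_tsum hle (hs.mul_left _))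
          (tsum_nonneg fun _ => sq_nonneg _)
    _ = _ := by
        rw [tsum_mul_left, greenSumConst]
        simp only [div_pow, one_pow]
        ring

/-- The sums against Green's functions of the shifted half-lines solve the equation. -/
lemma tsum_green_recurrence (ha : ∀ i, a i ≠ 0) {h : ℕ → ℂ}
    (h0 : Summable fun i => green m a i * h i)
    (h1 : Summable fun i => green m (fun l => a (l + 1)) i * h (i + 1))
    (h2 : Summable fun i => green m (fun l => a (l + 2)) i * h (i + 2)) :
    a 0 * ∑' i, green m a i * h i
      + 2 * m * ∑' i, green m (fun l => a (l + 1)) i * h (i + 1)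
      - conj (a 1) * ∑' i, green m (fun l => a (l + 2)) i * h (i + 2) = 2 * h 1 := by
  rw [h0.tsum_eq_zero_add, ((summable_nat_add_iff 1).2 h0).tsum_eq_zero_add,
    h1.tsum_eq_zero_add]
  have e0 := ((summable_nat_add_iff 2).2 h0).hasSum.mul_left (a 0)
  have e1 := ((summable_nat_add_iff 1).2 h1).hasSum.mul_left (2 * (m : ℂ))
  have e2 := h2.hasSum.mul_left (conj (a 1))
  -- For each `i` the terms containing `h (i + 2)` cancel. What survives is the pole `a 0 * green m
  -- a 1 = 2`, which produces the right-hand side `2 * h 1`.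
  have hz : ∀ i, a 0 * (green m a (i + 2) * h (i + 2))
      + 2 * m * (green m (fun l => a (l + 1)) (i + 1) * h (i + 1 + 1))
      - conj (a 1) * (green m (fun l => a (l + 2)) i * h (i + 2)) = 0 := fun i => by
    linear_combination h (i + 2) * green_shift (m := m) ha i
  have e := ((e0.add e1).sub e2).unique (by simpa only [hz] using hasSum_zero)
  simp only [zero_add, green_zero, green_one, zero_mul]
  have ha0 : a 0 * (2 / a 0) = 2 := mul_div_cancel₀ _ (ha 0)
  linear_combination e + h 1 * ha0

end Green
end TwistedSL2

/-! ### Weights, Casimir parameters and the spectral gap -/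

namespace TwistedSL2

namespace Series

variable {P : Series}

/-- The weight `1 + μ + 2 k²` of the Sobolev norms. -/
noncomputable def weight (P : Series) (k : ℤ) : ℝ := 1 + P.mu + 2 * (k : ℝ) ^ 2

lemma mu_eq (P : Series) : (P.mu : ℂ) = 1 - P.nu ^ 2 := by
  cases P <;> simp [mu, nu, mul_pow]

lemma one_add_sq_le_weight {u₀ : ℝ} (hu₁ : u₀ < 1) (hP : P.HasGap u₀) {k : ℤ}
    (hk : k ∈ P.weights) : 1 + (k : ℝ) ^ 2 ≤ P.weight k := by
  cases P with
  | principalEven r => simp only [weight, mu]; nlinarith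
  | principalOdd r => simp only [weight, mu]; nlinarith
  | complementary ν =>
    have h := hP.2
    have h1 : ν ^ 2 ≤ 1 := by
      rw [sq_le_one_iff_abs_le_one]; linarith
    simp only [weight, mu]; nlinarith
  | holomorphic n =>
    have h : ((n : ℝ) + 1) ≤ k := by exact_mod_cast hk.1
    have : (0 : ℝ) ≤ n := by positivity
    simp only [weight, mu]; nlinarith
  | antiholomorphic n =>
    have h : (k : ℝ) ≤ -((n : ℝ) + 1) := by exact_mod_cast hk.1
    have : (0 : ℝ) ≤ n := by positivity
    simp only [weight, mu]; nlinarith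

/-- Lower bound for the squared norm of the ladder coefficients `2 i` steps away from `k`. -/
lemma sq_le_ladder {u₀ : ℝ} (hu₀ : 0 < u₀) (hu₁ : u₀ < 1) (hP : P.HasGap u₀) {k : ℤ}
    (hk : k ∈ P.weights) (i : ℕ) :
    (2 * i + (1 - u₀)) ^ 2 ≤ (|(k : ℝ)| + 2 * i + 1) ^ 2 + P.mu - 1 := by
  have hi : (0 : ℝ) ≤ i := by positivity
  have hk0 := abs_nonneg (k : ℝ)
  have h0 : (2 * (i : ℝ) + 1) ^ 2 ≤ (|(k : ℝ)| + 2 * i + 1) ^ 2 := by gcongr; linarith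
  have h1 : (2 * i + (1 - u₀)) ^ 2 ≤ (2 * (i : ℝ) + 1) ^ 2 := by
    gcongr
    linarith
  cases P with
  | principalEven r => simp only [mu]; nlinarith
  | principalOdd r => simp only [mu]; nlinarith
  | complementary ν =>
    have h : ν ^ 2 ≤ u₀ ^ 2 := sq_le_sq' (by linarith [neg_abs_le ν, hP.2])
      ((le_abs_self ν).trans hP.2.le)
    simp only [mu]; nlinarith
  | holomorphic n =>
    have h : ((n : ℝ) + 1) ≤ k := by exact_mod_cast hk.1
    have hk1 := h.trans (le_abs_self _)
    have : (0 : ℝ) ≤ n := by positivity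
    have h2 : ((n : ℝ) + (2 * i + 1)) ^ 2 ≤ (|(k : ℝ)| + 2 * i + 1) ^ 2 := by
      gcongr ?_ ^ 2
      linarith
    simp only [mu]; nlinarith
  | antiholomorphic n =>
    have h : (k : ℝ) ≤ -((n : ℝ) + 1) := by exact_mod_cast hk.1
    have hk1 : (n : ℝ) + 1 ≤ |(k : ℝ)| := by linarith [neg_abs_le (k : ℝ)]
    have : (0 : ℝ) ≤ n := by positivity
    have h2 : ((n : ℝ) + (2 * i + 1)) ^ 2 ≤ (|(k : ℝ)| + 2 * i + 1) ^ 2 := by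
      gcongr ?_ ^ 2
      linarith
    simp only [mu]; nlinarith

lemma add_two_mem {k : ℤ} (hk : k ∈ P.weights) (h0 : 0 < k) : k + 2 ∈ P.weights := by
  cases P <;> simp only [weights, Set.mem_ofPred_eq, Int.even_iff, Int.odd_iff] at * <;> omega

lemma sub_two_mem {k : ℤ} (hk : k ∈ P.weights) (h0 : k ≤ 0) : k - 2 ∈ P.weights := by
  cases P <;> simp only [weights, Set.mem_ofPred_eq, Int.even_iff, Int.odd_iff] at * <;> omega

lemma obstructions_subset {k : ℤ} (hk : k ∈ P.obstructions) : k ∈ P.weights := by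
  cases P <;> simp only [weights, obstructions, Set.mem_ofPred_eq, Int.even_iff, Int.odd_iff,
    Finset.mem_insert, Finset.mem_singleton] at * <;> omega

/-- Away from the obstructions, either `k - 2` or `k + 2` is a weight on the same side of zero
as `k`. -/
lemma mem_of_notMem_obstructions {k : ℤ} (hk : k ∈ P.weights) (h : k ∉ P.obstructions) :
    (0 < k - 2 ∧ k - 2 ∈ P.weights) ∨ (k + 2 ≤ 0 ∧ k + 2 ∈ P.weights) := by
  cases P <;> simp only [weights, obstructions, Set.mem_ofPred_eq, Int.even_iff, Int.odd_iff,
    Finset.mem_insert, Finset.mem_singleton] at * <;> omega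

/-- This drives the induction outward from the minimal weights. The values `±1` are excluded because
both are minimal in the odd principal series, so no step has to cross from `-1` to `1`. -/
lemma minimal_or_mem {k : ℤ} (hk : k ∈ P.weights) :
    (∀ j ∈ P.weights, |k| ≤ |j|) ∨ (0 < k ∧ k ≠ 1 ∧ k - 2 ∈ P.weights) ∨
      (k < 0 ∧ k ≠ -1 ∧ k + 2 ∈ P.weights) := by
  by_cases h1 : 0 < k ∧ k ≠ 1 ∧ k - 2 ∈ P.weights
  · exact Or.inr (Or.inl h1)
  by_cases h2 : k < 0 ∧ k ≠ -1 ∧ k + 2 ∈ P.weights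
  · exact Or.inr (Or.inr h2)
  left
  intro j hj
  rw [Int.abs_eq_natAbs, Int.abs_eq_natAbs]
  cases P <;> simp only [weights, Set.mem_ofPred_eq, Int.even_iff, Int.odd_iff] at * <;> omega

end Series

end TwistedSL2

/-! ### The generator of the geodesic flow: skew-symmetric and closed -/

namespace TwistedSL2

open scoped ComplexConjugate

lemma expX_zero : expX 0 = 1 := by
  ext i j
  fin_cases i <;> fin_cases j <;> simp [expX]

lemma expX_add (s t : ℝ) : expX (s + t) = expX s * expX t := by
  ext i j
  rw [Matrix.SpecialLinearGroup.coe_mul]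
  fin_cases i <;> fin_cases j <;> simp [expX, Real.exp_add, mul_comm]

section Generator

variable {H : Type*} [NormedAddCommGroup H] [InnerProductSpace ℂ H] {π : UnitaryRep H}

lemma Derives.add {γ : ℝ → SL(2, ℝ)} {v w v' w' : H} (h : Derives π γ v w)
    (h' : Derives π γ v' w') : Derives π γ (v + v') (w + w') := by
  have := HasDerivAt.add h h'
  refine this.congr_of_eventuallyEq (Filter.Eventually.of_forall fun t => ?_)
  simp

lemma Derives.smul {γ : ℝ → SL(2, ℝ)} {v w : H} (c : ℂ) (h : Derives π γ v w) :
    Derives π γ (c • v) (c • w) := by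
  have := HasDerivAt.const_smul c h
  refine this.congr_of_eventuallyEq (Filter.Eventually.of_forall fun t => ?_)
  simp

lemma Derives.zero {γ : ℝ → SL(2, ℝ)} : Derives π γ 0 0 := by
  simpa [Derives] using hasDerivAt_const (0 : ℝ) (0 : H)

lemma Derives.sub {γ : ℝ → SL(2, ℝ)} {v w v' w' : H} (h : Derives π γ v w)
    (h' : Derives π γ v' w') : Derives π γ (v - v') (w - w') := by
  simpa [sub_eq_add_neg] using h.add (h'.smul (-1))

lemma Derives.sum {γ : ℝ → SL(2, ℝ)} {ι : Type*} (s : Finset ι) {v w : ι → H}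
    (h : ∀ i ∈ s, Derives π γ (v i) (w i)) : Derives π γ (∑ i ∈ s, v i) (∑ i ∈ s, w i) := by
  classical
  induction s using Finset.induction_on with
  | empty => simpa using Derives.zero
  | insert a s ha ih =>
    rw [Finset.sum_insert ha, Finset.sum_insert ha]
    exact (h a (Finset.mem_insert_self _ _)).add
      (ih fun i hi => h i (Finset.mem_insert_of_mem hi))

/-- The generator of a one-parameter unitary group is skew-symmetric. -/
lemma Derives.inner_add_inner {a a' b b' : H} (ha : Derives π expX a a')
    (hb : Derives π expX b b') : ⟪a', b⟫_ℂ + ⟪a, b'⟫_ℂ = 0 := by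
  have h := HasDerivAt.inner ℂ ha hb
  have hc : (fun t => ⟪π.toHom (expX t) a, π.toHom (expX t) b⟫_ℂ) = fun _ => ⟪a, b⟫_ℂ := by
    funext t
    exact LinearIsometryEquiv.inner_map_map _ _ _
  rw [hc] at h
  have := h.unique (hasDerivAt_const _ _)
  simpa [expX_zero, add_comm] using this

lemma Derives.hasDerivAt {v w : H} (h : Derives π expX v w) (t : ℝ) :
    HasDerivAt (fun t : ℝ => π.toHom (expX t) v) (π.toHom (expX t) w) t := by
  have h1 : HasDerivAt (fun s : ℝ => π.toHom (expX s) v) w (t - t) := by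
    rw [sub_self]; exact h
  have h2 := h1.comp_sub_const t t
  have h3 := ((π.toHom (expX t)).toContinuousLinearEquiv.toContinuousLinearMap.restrictScalars
    ℝ).hasFDerivAt.comp_hasDerivAt t h2
  refine h3.congr_of_eventuallyEq (Filter.Eventually.of_forall fun s => ?_)
  have e : expX s = expX t * expX (s - t) := by rw [← expX_add]; congr 1; ring
  simp [e]

lemma Derives.norm_sub_le {v w : H} (h : Derives π expX v w) (t : ℝ) :
    ‖π.toHom (expX t) v - v‖ ≤ ‖w‖ * |t| := by
  have := Convex.norm_image_sub_le_of_norm_hasDerivWithin_le (s := Set.univ) (C := ‖w‖)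
    (fun x _ => (h.hasDerivAt x).hasDerivWithinAt) (fun x _ => by simp) convex_univ
    (Set.mem_univ (0 : ℝ)) (Set.mem_univ t)
  simpa [expX_zero] using this

/-- The generator of a one-parameter unitary group is closed. -/
lemma Derives.of_tendsto {ι : Type*} {l : Filter ι} [l.NeBot] {v w : ι → H} {f g : H}
    (h : ∀ i, Derives π expX (v i) (w i)) (hv : Filter.Tendsto v l (nhds f))
    (hw : Filter.Tendsto w l (nhds g)) : Derives π expX f g := by
  -- Uniformity in `t` is the point: the difference quotients of `f - v i` are bounded by `‖g - w
  -- i‖`, by passing to the limit in the mean value bound for `v j - v i`. A single good `i` then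
  -- suffices for all small `t`.
  have key : ∀ i t, ‖π.toHom (expX t) (f - v i) - (f - v i)‖ ≤ ‖g - w i‖ * |t| := by
    intro i t
    have h1 : Filter.Tendsto (fun j => ‖π.toHom (expX t) (v j - v i) - (v j - v i)‖) l
        (nhds ‖π.toHom (expX t) (f - v i) - (f - v i)‖) :=
      ((((π.toHom (expX t)).continuous.tendsto _).comp (hv.sub_const (v i))).sub
        (hv.sub_const (v i))).norm
    have h2 : Filter.Tendsto (fun j => ‖w j - w i‖ * |t|) l (nhds (‖g - w i‖ * |t|)) :=
      (hw.sub_const (w i)).norm.mul_const _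
    exact le_of_tendsto_of_tendsto' h1 h2 fun j => ((h j).sub (h i)).norm_sub_le t
  unfold Derives
  rw [hasDerivAt_iff_isLittleO_nhds_zero, Asymptotics.isLittleO_iff]
  intro ε hε
  obtain ⟨i, hi⟩ := (hw.eventually (Metric.ball_mem_nhds g (by positivity : 0 < ε / 3))).exists
  have hi' : ‖g - w i‖ < ε / 3 := by
    rw [← dist_eq_norm, dist_comm]; exact hi
  have hd := h i
  unfold Derives at hd
  rw [hasDerivAt_iff_isLittleO_nhds_zero, Asymptotics.isLittleO_iff] at hd
  filter_upwards [hd (by positivity : 0 < ε / 3)] with t ht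
  have h1 := key i t
  simp only [zero_add, expX_zero, map_one, LinearIsometryEquiv.coe_one, id_eq, map_sub,
    Real.norm_eq_abs] at ht h1 ⊢
  have e : π.toHom (expX t) f - f - t • g =
      (π.toHom (expX t) f - π.toHom (expX t) (v i) - (f - v i)) +
      (π.toHom (expX t) (v i) - v i - t • w i) - t • (g - w i) := by
    rw [smul_sub]; abel
  rw [e]
  have h2 : ‖t • (g - w i)‖ ≤ ε / 3 * |t| := by
    rw [norm_smul, mul_comm, Real.norm_eq_abs]; gcongr
  have h3 : ‖g - w i‖ * |t| ≤ ε / 3 * |t| := by gcongr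
  refine (_root_.norm_sub_le _ _).trans ?_
  have h4 := norm_add_le (π.toHom (expX t) f - π.toHom (expX t) (v i) - (f - v i))
    (π.toHom (expX t) (v i) - v i - t • w i)
  linarith

lemma Derives.of_hasSum {ι : Type*} {v w : ι → H} {f g : H}
    (h : ∀ i, Derives π expX (v i) (w i)) (hv : HasSum v f) (hw : HasSum w g) :
    Derives π expX f g :=
  Derives.of_tendsto (v := fun s : Finset ι => ∑ i ∈ s, v i) (fun s => Derives.sum s fun i _ => h i)
    hv hw

end Generator

/-! ### The action of `X` in the normalized adapted basis -/

section Basis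

variable {H : Type*} [NormedAddCommGroup H] [InnerProductSpace ℂ H]

/-- The normalized basis vectors. -/
noncomputable def unitVec (u : ℤ → H) (k : ℤ) : H := (‖u k‖ : ℂ)⁻¹ • u k

/-- The coefficients of `X` in the normalized basis:
`2 X v_k = A_k v_{k + 2} - conj A_{k - 2} v_{k - 2}`. -/
noncomputable def ladder (P : Series) (u : ℤ → H) (k : ℤ) : ℂ :=
  (1 + P.nu + k) * ‖u (k + 2)‖ / ‖u k‖

/-- The coordinates with respect to the normalized basis. -/
noncomputable def coord (u : ℤ → H) (v : H) (k : ℤ) : ℂ := ⟪unitVec u k, v⟫_ℂ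

lemma smul_unitVec (u : ℤ → H) (k : ℤ) : (‖u k‖ : ℂ) • unitVec u k = u k := by
  rcases eq_or_ne (u k) 0 with h | h
  · simp [unitVec, h]
  · rw [unitVec, smul_smul, mul_inv_cancel₀ (by simpa using h), one_smul]

lemma coord_eq (u : ℤ → H) (v : H) (k : ℤ) : coord u v k = ‖u k‖ * coeff u v k := by
  rw [coord, unitVec, coeff, inner_smul_left]
  rcases eq_or_ne (u k) 0 with h | h
  · simp [h]
  · have : (‖u k‖ : ℂ) ≠ 0 := by simpa using h
    rw [map_inv₀, Complex.conj_ofReal]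
    field_simp

lemma sobolevTerm_coeff (P : Series) (u : ℤ → H) (s : ℝ) (v : H) (k : ℤ) :
    sobolevTerm P u s (coeff u v) k = P.weight k ^ s * ‖coord u v k‖ ^ 2 := by
  rw [sobolevTerm, coord_eq, norm_mul, mul_pow, Series.weight, Complex.norm_real, norm_norm,
    mul_assoc]

variable {π : UnitaryRep H} {P : Series} {u : ℤ → H}

namespace IsAdaptedBasis

lemma derives (hu : IsAdaptedBasis π P u) {k : ℤ} (hk : k ∈ P.weights) :
    Derives π expX (u k) ((1 / 2 : ℂ) •
      ((1 + P.nu + k) • u (k + 2) + (1 + P.nu - k) • u (k - 2))) := by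
  obtain ⟨x, y, z, hx, -, -, -, h1, h2⟩ := hu.action k hk
  have : x = (1 / 2 : ℂ) • ((1 + P.nu + k) • u (k + 2) + (1 + P.nu - k) • u (k - 2)) := by
    rw [← h1, ← h2, add_add_sub_cancel, ← two_smul ℂ x, smul_smul]
    norm_num
  rwa [← this]

/-- Skew-symmetry of `X`, tested on the pair `u_k`, `u_{k+2}`. -/
lemma conj_mul_sq (hu : IsAdaptedBasis π P u) {k : ℤ} (hk : k ∈ P.weights)
    (hk2 : k + 2 ∈ P.weights) :
    conj (1 + P.nu + k) * (‖u (k + 2)‖ : ℂ) ^ 2 = (k + 1 - P.nu) * (‖u k‖ : ℂ) ^ 2 := by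
  have h := (hu.derives hk).inner_add_inner (hu.derives hk2)
  simp only [inner_smul_left, inner_smul_right, inner_add_left, inner_add_right,
    hu.orthogonal (k - 2) (k + 2) (by omega), hu.orthogonal k (k + 2 + 2) (by omega),
    add_sub_cancel_right, inner_self_eq_norm_sq_to_K] at h
  push_cast at h
  simp only [map_div₀, map_one, map_ofNat, Complex.coe_algebraMap] at h
  linear_combination 2 * h

variable {u₀ : ℝ}

/-- Nonvanishing is not an axiom of the basis. It holds at the weights of minimal modulus by
normalization and spreads outward through `conj_mul_sq`, whose coefficients are nonzero by the gap.
-/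
lemma norm_pos (hu₀ : 0 < u₀) (hu₁ : u₀ < 1) (hP : P.HasGap u₀) (hu : IsAdaptedBasis π P u)
    {k : ℤ} (hk : k ∈ P.weights) : 0 < ‖u k‖ := by
  -- At `k = -1` the coefficients do vanish when `ν = 0` (odd principal series), hence the condition
  -- `k + 1 ≠ 0`.
  have hne : ∀ k : ℤ, k ∈ P.weights → k + 2 ∈ P.weights → k + 1 ≠ 0 →
      (1 + P.nu + k ≠ 0) ∧ (k + 1 - P.nu ≠ 0) := by
    intro k hk hk2 h0
    have hpos : (0 : ℝ) < (k + 1) ^ 2 + P.mu - 1 := by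
      rcases lt_or_gt_of_ne h0 with h | h
      · have h1 := Series.sq_le_ladder hu₀ hu₁ hP hk2 0
        have h2 : ((k + 2 : ℤ) : ℝ) ≤ 0 := by exact_mod_cast (by omega : k + 2 ≤ 0)
        rw [abs_of_nonpos h2] at h1
        push_cast at h1
        nlinarith
      · have h1 := Series.sq_le_ladder hu₀ hu₁ hP hk 0
        have h2 : (0 : ℝ) ≤ k := by exact_mod_cast (by omega : 0 ≤ k)
        rw [abs_of_nonneg h2] at h1
        push_cast at h1
        nlinarith
    have he : (1 + P.nu + k) * (k + 1 - P.nu) = (((k + 1) ^ 2 + P.mu - 1 : ℝ) : ℂ) := by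
      push_cast
      rw [P.mu_eq]
      ring
    have hprod : (1 + P.nu + k) * (k + 1 - P.nu) ≠ 0 := by
      rw [he]
      exact_mod_cast hpos.ne'
    exact ⟨left_ne_zero_of_mul hprod, right_ne_zero_of_mul hprod⟩
  induction hn : k.natAbs using Nat.strong_induction_on generalizing k with
  | _ n ih =>
  rcases Series.minimal_or_mem hk with h | ⟨h0, h1, h2⟩ | ⟨h0, h1, h2⟩
  · rw [hu.normalized k hk h]
    exact one_pos
  · have hlt := ih (k - 2).natAbs (by omega) h2 rfl
    have h3 := hu.conj_mul_sq h2 (by rwa [sub_add_cancel])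
    have h4 := (hne (k - 2) h2 (by rwa [sub_add_cancel]) (by omega)).2
    rw [sub_add_cancel] at h3
    refine (norm_nonneg _).lt_of_ne fun h5 => ?_
    rw [← h5] at h3
    have h6 : (‖u (k - 2)‖ : ℂ) ≠ 0 := by exact_mod_cast hlt.ne'
    exact (mul_ne_zero h4 (pow_ne_zero 2 h6)) (by rw [← h3]; simp)
  · have hlt := ih (k + 2).natAbs (by omega) h2 rfl
    have h3 := hu.conj_mul_sq hk h2
    have h4 := (hne k hk h2 (by omega)).1
    refine (norm_nonneg _).lt_of_ne fun h5 => ?_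
    rw [← h5] at h3
    have h6 : (‖u (k + 2)‖ : ℂ) ≠ 0 := by exact_mod_cast hlt.ne'
    exact (mul_ne_zero ((map_ne_zero (starRingEnd ℂ)).2 h4) (pow_ne_zero 2 h6))
      (by rw [h3]; simp)

lemma ladder_eq_zero (hu : IsAdaptedBasis π P u) {k : ℤ}
    (h : k ∉ P.weights ∨ k + 2 ∉ P.weights) : ladder P u k = 0 := by
  rcases h with h | h <;> simp [ladder, hu.eq_zero _ h]

lemma conj_ladder (hu₀ : 0 < u₀) (hu₁ : u₀ < 1) (hP : P.HasGap u₀) (hu : IsAdaptedBasis π P u)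
    {k : ℤ} (hk : k ∈ P.weights) (hk2 : k + 2 ∈ P.weights) :
    conj (ladder P u k) = (k + 1 - P.nu) * ‖u k‖ / ‖u (k + 2)‖ := by
  have h1 : (‖u k‖ : ℂ) ≠ 0 := by exact_mod_cast (norm_pos hu₀ hu₁ hP hu hk).ne'
  have h2 : (‖u (k + 2)‖ : ℂ) ≠ 0 := by exact_mod_cast (norm_pos hu₀ hu₁ hP hu hk2).ne'
  rw [ladder, map_div₀, map_mul, Complex.conj_ofReal, Complex.conj_ofReal]
  field_simp
  linear_combination hu.conj_mul_sq hk hk2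

/-- Multiplying the ladder coefficient by its conjugate, computed from `conj_ladder`, cancels the
norms of the basis vectors and leaves `(k + 1 + ν) (k + 1 - ν)`. -/
lemma norm_ladder_sq (hu₀ : 0 < u₀) (hu₁ : u₀ < 1) (hP : P.HasGap u₀)
    (hu : IsAdaptedBasis π P u) {k : ℤ} (hk : k ∈ P.weights) (hk2 : k + 2 ∈ P.weights) :
    ‖ladder P u k‖ ^ 2 = ((k : ℝ) + 1) ^ 2 + P.mu - 1 := by
  have h1 : (‖u k‖ : ℂ) ≠ 0 := by exact_mod_cast (norm_pos hu₀ hu₁ hP hu hk).ne'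
  have h2 : (‖u (k + 2)‖ : ℂ) ≠ 0 := by exact_mod_cast (norm_pos hu₀ hu₁ hP hu hk2).ne'
  have h := Complex.mul_conj' (ladder P u k)
  rw [conj_ladder hu₀ hu₁ hP hu hk hk2, ladder] at h
  have : ((‖ladder P u k‖ ^ 2 : ℝ) : ℂ) = ((((k : ℝ) + 1) ^ 2 + P.mu - 1 : ℝ) : ℂ) := by
    push_cast
    rw [ladder, ← h, P.mu_eq]
    field_simp
    ring
  exact_mod_cast this

lemma norm_ladder_le (hu₀ : 0 < u₀) (hu₁ : u₀ < 1) (hP : P.HasGap u₀)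
    (hu : IsAdaptedBasis π P u) {k : ℤ} (hk : k ∈ P.weights) :
    ‖ladder P u k‖ ≤ P.weight k ^ (1 / 2 : ℝ) ∧
      ‖ladder P u (k - 2)‖ ≤ P.weight k ^ (1 / 2 : ℝ) := by
  rw [← Real.sqrt_eq_rpow]
  constructor
  · by_cases h : k + 2 ∈ P.weights
    · refine Real.le_sqrt_of_sq_le ?_
      rw [norm_ladder_sq hu₀ hu₁ hP hu hk h, Series.weight]
      nlinarith [sq_nonneg ((k : ℝ) - 1)]
    · rw [ladder_eq_zero hu (Or.inr h), norm_zero]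
      exact Real.sqrt_nonneg _
  · by_cases h : k - 2 ∈ P.weights
    · refine Real.le_sqrt_of_sq_le ?_
      rw [norm_ladder_sq hu₀ hu₁ hP hu h (by rwa [sub_add_cancel]), Series.weight]
      push_cast
      nlinarith [sq_nonneg ((k : ℝ) + 1)]
    · rw [ladder_eq_zero hu (Or.inl h), norm_zero]
      exact Real.sqrt_nonneg _

lemma unitVec_eq_zero (hu : IsAdaptedBasis π P u) {k : ℤ} (hk : k ∉ P.weights) :
    unitVec u k = 0 := by
  simp [unitVec, hu.eq_zero k hk]

lemma coord_eq_zero (hu : IsAdaptedBasis π P u) {k : ℤ} (hk : k ∉ P.weights) (v : H) :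
    coord u v k = 0 := by
  simp [coord, unitVec_eq_zero hu hk]

lemma norm_unitVec_le (k : ℤ) : ‖unitVec u k‖ ≤ 1 := by
  rcases eq_or_ne (u k) 0 with h | h
  · simp [unitVec, h]
  · rw [unitVec, norm_smul, norm_inv, Complex.norm_real, norm_norm,
      inv_mul_cancel₀ (norm_ne_zero_iff.2 h)]

lemma inner_unitVec_self (hu₀ : 0 < u₀) (hu₁ : u₀ < 1) (hP : P.HasGap u₀)
    (hu : IsAdaptedBasis π P u) {k : ℤ} (hk : k ∈ P.weights) :
    ⟪unitVec u k, unitVec u k⟫_ℂ = 1 := by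
  have h1 : (‖u k‖ : ℂ) ≠ 0 := by exact_mod_cast (norm_pos hu₀ hu₁ hP hu hk).ne'
  rw [unitVec, inner_smul_left, inner_smul_right, inner_self_eq_norm_sq_to_K, map_inv₀,
    Complex.conj_ofReal]
  simp only [Complex.coe_algebraMap]
  field_simp

lemma inner_unitVec_of_ne (hu : IsAdaptedBasis π P u) {j k : ℤ} (h : j ≠ k) :
    ⟪unitVec u j, unitVec u k⟫_ℂ = 0 := by
  rw [unitVec, unitVec, inner_smul_left, inner_smul_right, hu.orthogonal j k h, mul_zero, mul_zero]

/-- The action of `X` in the normalized basis. -/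
lemma derives_unitVec (hu₀ : 0 < u₀) (hu₁ : u₀ < 1) (hP : P.HasGap u₀)
    (hu : IsAdaptedBasis π P u) (k : ℤ) :
    Derives π expX (unitVec u k) ((1 / 2 : ℂ) •
      (ladder P u k • unitVec u (k + 2) - conj (ladder P u (k - 2)) • unitVec u (k - 2))) := by
  by_cases hk : k ∈ P.weights
  · have h1 : (‖u k‖ : ℂ) ≠ 0 := by exact_mod_cast (norm_pos hu₀ hu₁ hP hu hk).ne'
    have h := (hu.derives hk).smul (‖u k‖ : ℂ)⁻¹
    rw [← unitVec] at h
    convert h using 1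
    rw [smul_comm (‖u k‖ : ℂ)⁻¹, smul_add, sub_eq_add_neg]
    congr 2
    · rw [← smul_unitVec u (k + 2), smul_smul, smul_smul, ladder]
      congr 1
      ring
    · by_cases hk2 : k - 2 ∈ P.weights
      · have e := conj_ladder hu₀ hu₁ hP hu hk2 (by rwa [sub_add_cancel])
        rw [sub_add_cancel] at e
        rw [e, ← smul_unitVec u (k - 2), smul_smul, smul_smul, smul_unitVec, ← neg_smul]
        congr 1
        push_cast
        field_simp
        ring
      · simp [unitVec_eq_zero hu hk2, hu.eq_zero _ hk2]
  · rw [unitVec_eq_zero hu hk, ladder_eq_zero hu (Or.inl hk),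
      ladder_eq_zero hu (k := k - 2) (Or.inr (by rwa [sub_add_cancel]))]
    simpa using Derives.zero

/-- `X` is moved onto the basis vector by skew-symmetry, so `f` need only lie in the domain of `X`
and its series is never differentiated term by term. -/
lemma coord_derives (hu₀ : 0 < u₀) (hu₁ : u₀ < 1) (hP : P.HasGap u₀)
    (hu : IsAdaptedBasis π P u) {f w : H} (h : Derives π expX f w) (k : ℤ) :
    2 * coord u w k = ladder P u (k - 2) * coord u f (k - 2)
      - conj (ladder P u k) * coord u f (k + 2) := by
  have := (derives_unitVec hu₀ hu₁ hP hu k).inner_add_inner h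
  simp only [inner_smul_left, inner_sub_left, map_div₀, map_one, map_ofNat,
    Complex.conj_conj] at this
  simp only [coord]
  linear_combination 2 * this

lemma ext_coord [CompleteSpace H] (hu : IsAdaptedBasis π P u) {v w : H}
    (h : ∀ k, coord u v k = coord u w k) : v = w := by
  have h1 : v - w ∈ (Submodule.span ℂ (Set.range u))ᗮ := by
    rw [Submodule.mem_orthogonal]
    intro x hx
    induction hx using Submodule.span_induction with
    | mem x hx =>
      obtain ⟨k, rfl⟩ := hx
      have := h k
      rw [← smul_unitVec u k, inner_smul_left, inner_sub_right]
      simp only [coord] at this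
      rw [this, sub_self, mul_zero]
    | zero => simp
    | add x y _ _ hx hy => rw [inner_add_left, hx, hy, add_zero]
    | smul a x _ hx => rw [inner_smul_left, hx, mul_zero]
  rw [Submodule.topologicalClosure_eq_top_iff.1 hu.total, Submodule.mem_bot] at h1
  exact sub_eq_zero.1 h1

end IsAdaptedBasis

end Basis

end TwistedSL2

/-! ### The solution decaying at infinity, its bounds and its uniqueness -/

namespace TwistedSL2

open scoped ComplexConjugate

/-- The lattice points `j, j ± 2, j ± 4, …` that move away from zero. -/
def node (j : ℤ) (i : ℕ) : ℤ := if 0 < j then j + 2 * i else j - 2 * i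

/-- The ladder coefficients along `node j`. -/
noncomputable def halfLine (A : ℤ → ℂ) (j : ℤ) (i : ℕ) : ℂ :=
  if 0 < j then A (j + 2 * i) else -conj (A (j - 2 * i - 2))

/-- The label of the tail of the right-hand side on which the `j`-th coordinate of the solution
depends. -/
def tailStart (j : ℤ) : ℤ := if 0 < j then j + 2 else j - 2

lemma natAbs_node (j : ℤ) (i : ℕ) : (node j i).natAbs = j.natAbs + 2 * i := by
  unfold node; split_ifs <;> omega

lemma abs_node (j : ℤ) (i : ℕ) : |(node j i : ℝ)| = |(j : ℝ)| + 2 * i := by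
  rw [← Int.cast_abs, ← Int.cast_abs, Int.abs_eq_natAbs, Int.abs_eq_natAbs, natAbs_node]
  push_cast
  ring

lemma node_injective (j : ℤ) : Function.Injective (node j) := by
  intro i i' h
  have := congrArg Int.natAbs h
  rw [natAbs_node, natAbs_node] at this
  omega

lemma Series.node_mem {P : Series} {j : ℤ} (hj : j ∈ P.weights) (i : ℕ) :
    node j i ∈ P.weights := by
  induction i with
  | zero => simpa [node] using hj
  | succ i ih =>
    unfold node at ih ⊢
    split_ifs at ih ⊢ with h
    · have := P.add_two_mem ih (by omega)
      convert this using 1; push_cast; ring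
    · have := P.sub_two_mem ih (by omega)
      convert this using 1; push_cast; ring

lemma tail_node (j : ℤ) (i : ℕ) (y : ℤ → ℂ) :
    tail (tailStart j) y (node j i) = if i = 0 then 0 else y (node j i) := by
  unfold tail tailStart node
  split_ifs <;> first | rfl | omega

lemma norm_tail_le (n : ℤ) (y : ℤ → ℂ) (k : ℤ) : ‖tail n y k‖ ≤ ‖y k‖ := by
  unfold tail; split_ifs <;> simp

section Solution

open Classical in
/-- The coordinates of the solution of `(X + m) f = g` (away from the obstructions). -/
noncomputable def solution (P : Series) (A : ℤ → ℂ) (m : ℝ) (y : ℤ → ℂ) (j : ℤ) : ℂ :=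
  if j ∈ P.weights then ∑' i, green m (halfLine A j) i * y (node j i) else 0

/-- The residual at `n` of the equation `(X + m) f = g`. -/
noncomputable def residual (A : ℤ → ℂ) (m : ℝ) (F y : ℤ → ℂ) (n : ℤ) : ℂ :=
  (1 / 2) * (A (n - 2) * F (n - 2) + 2 * m * F n - conj (A n) * F (n + 2)) - y n

variable {H : Type*} [NormedAddCommGroup H] [InnerProductSpace ℂ H]

/-- A representation with a spectral gap, together with its adapted basis. -/
structure GapModel (u₀ : ℝ) (π : UnitaryRep H) (P : Series) (u : ℤ → H) : Prop where
  pos : 0 < u₀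
  lt_one : u₀ < 1
  gap : P.HasGap u₀
  basis : IsAdaptedBasis π P u

/-- The squared Sobolev norm of order `s` in terms of normalized coordinates. -/
noncomputable def energy (P : Series) (s : ℝ) (y : ℤ → ℂ) : ℝ :=
  ∑' k, P.weight k ^ s * ‖y k‖ ^ 2

/-- Finiteness of the squared Sobolev norm, for coordinates supported on the weights. -/
def FiniteEnergy (P : Series) (s : ℝ) (y : ℤ → ℂ) : Prop :=
  (∀ k, k ∉ P.weights → y k = 0) ∧ Summable fun k => P.weight k ^ s * ‖y k‖ ^ 2

/-- The summands of the squared norm of `Θ ^ ((|m| + 3) / 2)` applied to the tail of a series. -/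
noncomputable def tailTerm (P : Series) (m τ : ℝ) (y : ℤ → ℂ) (j k : ℤ) : ℝ :=
  |(k : ℝ)| ^ (|m| + 3) * P.weight k ^ (τ + 1 / 2) * ‖tail (tailStart j) y k‖ ^ 2

namespace GapModel

variable {u₀ : ℝ} {π : UnitaryRep H} {P : Series} {u : ℤ → H} {m : ℝ}

lemma one_add_sq_le (S : GapModel u₀ π P u) {k : ℤ} (hk : k ∈ P.weights) :
    1 + (k : ℝ) ^ 2 ≤ P.weight k := P.one_add_sq_le_weight S.lt_one S.gap hk

lemma one_le (S : GapModel u₀ π P u) {k : ℤ} (hk : k ∈ P.weights) : 1 ≤ P.weight k := by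
  nlinarith [S.one_add_sq_le hk]

lemma term_nonneg (S : GapModel u₀ π P u) {y : ℤ → ℂ} (hy : ∀ k, k ∉ P.weights → y k = 0)
    (s : ℝ) (k : ℤ) : 0 ≤ P.weight k ^ s * ‖y k‖ ^ 2 := by
  by_cases hk : k ∈ P.weights
  · have := S.one_le hk
    positivity
  · simp [hy k hk]

lemma term_mono (S : GapModel u₀ π P u) {y : ℤ → ℂ} (hy : ∀ k, k ∉ P.weights → y k = 0)
    {s s' : ℝ} (h : s' ≤ s) (k : ℤ) :
    P.weight k ^ s' * ‖y k‖ ^ 2 ≤ P.weight k ^ s * ‖y k‖ ^ 2 := by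
  by_cases hk : k ∈ P.weights
  · have := S.one_le hk
    gcongr
  · simp [hy k hk]

lemma energy_nonneg (S : GapModel u₀ π P u) {y : ℤ → ℂ} (hy : ∀ k, k ∉ P.weights → y k = 0)
    (s : ℝ) : 0 ≤ energy P s y := tsum_nonneg (S.term_nonneg hy s)

lemma finiteEnergy_mono (S : GapModel u₀ π P u) {y : ℤ → ℂ} {s s' : ℝ} (h : s' ≤ s)
    (hy : FiniteEnergy P s y) : FiniteEnergy P s' y :=
  ⟨hy.1, Summable.of_nonneg_of_le (S.term_nonneg hy.1 s') (S.term_mono hy.1 h) hy.2⟩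

lemma energy_mono (S : GapModel u₀ π P u) {y : ℤ → ℂ} {s s' : ℝ} (h : s' ≤ s)
    (hy : FiniteEnergy P s y) : energy P s' y ≤ energy P s y :=
  (S.finiteEnergy_mono h hy).2.tsum_le_tsum (S.term_mono hy.1 h) hy.2

lemma norm_halfLine_sq (S : GapModel u₀ π P u) {j : ℤ} (hj : j ∈ P.weights) (i : ℕ) :
    ‖halfLine (ladder P u) j i‖ ^ 2 = (|(j : ℝ)| + 2 * i + 1) ^ 2 + P.mu - 1 := by
  have h1 := P.node_mem hj i
  have h2 := P.node_mem hj (i + 1)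
  unfold node at h1 h2
  unfold halfLine
  split_ifs at h1 h2 ⊢ with h
  · push_cast at h2
    rw [S.basis.norm_ladder_sq S.pos S.lt_one S.gap h1 (by convert h2 using 1; ring),
      abs_of_pos (by exact_mod_cast h)]
    push_cast
    ring
  · push_cast at h2
    rw [norm_neg, RCLike.norm_conj, S.basis.norm_ladder_sq S.pos S.lt_one S.gap
      (by convert h2 using 1; ring) (by convert h1 using 1; ring),
      abs_of_nonpos (by exact_mod_cast not_lt.1 h)]
    push_cast
    ring

lemma le_norm_halfLine (S : GapModel u₀ π P u) {j : ℤ} (hj : j ∈ P.weights) (i : ℕ) :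
    2 * i + (1 - u₀) ≤ ‖halfLine (ladder P u) j i‖ := by
  refine (le_abs_self _).trans (abs_le_of_sq_le_sq ?_ (norm_nonneg _))
  rw [S.norm_halfLine_sq hj]
  exact P.sq_le_ladder S.pos S.lt_one S.gap hj i

lemma halfLine_ne_zero (S : GapModel u₀ π P u) {j : ℤ} (hj : j ∈ P.weights) (i : ℕ) :
    halfLine (ladder P u) j i ≠ 0 := by
  have h := S.le_norm_halfLine hj i
  have h1 := S.lt_one
  rw [← norm_pos_iff]
  refine lt_of_lt_of_le ?_ h
  have : (0 : ℝ) ≤ i := by positivity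
  linarith

lemma norm_halfLine_mono (S : GapModel u₀ π P u) {j : ℤ} (hj : j ∈ P.weights) (i : ℕ) :
    ‖halfLine (ladder P u) j i‖ ≤ ‖halfLine (ladder P u) j (i + 1)‖ := by
  refine (le_abs_self _).trans (abs_le_of_sq_le_sq ?_ (norm_nonneg _))
  rw [S.norm_halfLine_sq hj, S.norm_halfLine_sq hj]
  gcongr
  simp

lemma norm_halfLine_sq_le (S : GapModel u₀ π P u) {j : ℤ} (hj : j ∈ P.weights) (i : ℕ) :
    ‖halfLine (ladder P u) j i‖ ^ 2 ≤ P.weight (node j i) ∧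
      ‖halfLine (ladder P u) j i‖ ^ 2 ≤ P.weight (node j (i + 1)) := by
  rw [S.norm_halfLine_sq hj, Series.weight, Series.weight, ← sq_abs (node j i : ℝ),
    ← sq_abs (node j (i + 1) : ℝ), abs_node, abs_node]
  have h1 : (0 : ℝ) ≤ i := by positivity
  have h2 := abs_nonneg (j : ℝ)
  push_cast
  constructor
  · nlinarith [sq_nonneg (|(j : ℝ)| + 2 * i - 1)]
  · nlinarith [sq_nonneg (|(j : ℝ)| + 2 * i)]

lemma sq_le_weight_node (S : GapModel u₀ π P u) {j : ℤ} (hj : j ∈ P.weights) (i : ℕ) :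
    1 + (i : ℝ) ^ 2 ≤ P.weight (node j i) := by
  have h := S.one_add_sq_le (P.node_mem hj i)
  rw [← sq_abs, abs_node] at h
  have h1 : (0 : ℝ) ≤ i := by positivity
  have h2 := abs_nonneg (j : ℝ)
  nlinarith

lemma tailTerm_nonneg (S : GapModel u₀ π P u) {y : ℤ → ℂ} (hy : ∀ k, k ∉ P.weights → y k = 0)
    (m τ : ℝ) (j k : ℤ) : 0 ≤ tailTerm P m τ y j k := by
  unfold tailTerm
  by_cases hk : k ∈ P.weights
  · have := S.one_le hk
    positivity
  · have := norm_tail_le (tailStart j) y k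
    rw [hy k hk, norm_zero] at this
    simp [norm_le_zero_iff.1 this]

lemma tailTerm_le (S : GapModel u₀ π P u) {y : ℤ → ℂ} (hy : ∀ k, k ∉ P.weights → y k = 0)
    (m τ : ℝ) (j k : ℤ) :
    tailTerm P m τ y j k ≤ P.weight k ^ (τ + |m| / 2 + 2) * ‖y k‖ ^ 2 := by
  have h := norm_tail_le (tailStart j) y k
  by_cases hk : k ∈ P.weights
  · have h1 := S.one_le hk
    have h2 := S.one_add_sq_le hk
    have h3 : |(k : ℝ)| ^ (|m| + 3) ≤ P.weight k ^ ((|m| + 3) / 2) := by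
      have e : |(k : ℝ)| ^ (|m| + 3) = (|(k : ℝ)| ^ 2) ^ ((|m| + 3) / 2) := by
        rw [← Real.rpow_natCast, ← Real.rpow_mul (abs_nonneg _)]
        congr 1
        push_cast
        ring
      rw [e, sq_abs]
      gcongr
      linarith
    have h4 : P.weight k ^ (τ + |m| / 2 + 2) =
        P.weight k ^ ((|m| + 3) / 2) * P.weight k ^ (τ + 1 / 2) := by
      rw [← Real.rpow_add (by linarith)]
      congr 1
      ring
    unfold tailTerm
    rw [h4]
    gcongr
  · rw [hy k hk, norm_zero] at h
    simp [tailTerm, norm_le_zero_iff.1 h, hy k hk]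

lemma summable_tailTerm (S : GapModel u₀ π P u) {y : ℤ → ℂ} {τ : ℝ} (m : ℝ)
    (hy : FiniteEnergy P (τ + |m| / 2 + 2) y) (j : ℤ) : Summable (tailTerm P m τ y j) :=
  Summable.of_nonneg_of_le (S.tailTerm_nonneg hy.1 m τ j) (S.tailTerm_le hy.1 m τ j) hy.2

lemma tsum_tailTerm_le (S : GapModel u₀ π P u) {y : ℤ → ℂ} {τ : ℝ} (m : ℝ)
    (hy : FiniteEnergy P (τ + |m| / 2 + 2) y) (j : ℤ) :
    ∑' k, tailTerm P m τ y j k ≤ energy P (τ + |m| / 2 + 2) y :=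
  (S.summable_tailTerm m hy j).tsum_le_tsum (S.tailTerm_le hy.1 m τ j) hy.2

/-- Green's function vanishes at its pole, so the coordinate at `j` sees only the part of `g`
strictly beyond `j`. This is why the tails start at `n ± 2`. -/
lemma green_mul_tail (m : ℝ) (a : ℕ → ℂ) (y : ℤ → ℂ) (j : ℤ) (i : ℕ) :
    green m a i * tail (tailStart j) y (node j i) = green m a i * y (node j i) := by
  rw [tail_node]
  split_ifs with h
  · simp [h, green_zero]
  · rfl

lemma summable_and_solution_bound (S : GapModel u₀ π P u) {y : ℤ → ℂ}
    (hy : FiniteEnergy P (|m| / 2 + 2) y) {j : ℤ} (hj : j ∈ P.weights) :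
    (Summable fun i => green m (halfLine (ladder P u) j) i * y (node j i)) ∧
      ‖solution P (ladder P u) m y j‖ ^ 2 ≤
        greenSumConst m (1 - u₀) * ∑' i, tailTerm P m 0 y j (node j i) := by
  have h := tsum_green_mul_bound (m := m) (sub_pos.2 S.lt_one) (S.le_norm_halfLine hj)
    (S.norm_halfLine_mono hj) (h := fun i => tail (tailStart j) y (node j i))
    (κ := fun i => |(node j i : ℝ)|) (W := fun i => P.weight (node j i))
    (fun i => by
      rw [abs_node]
      have := abs_nonneg (j : ℝ)
      have : (0 : ℝ) ≤ i := by positivity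
      linarith)
    (fun i => by linarith [S.sq_le_weight_node hj i])
    (by
      have := (S.summable_tailTerm (τ := 0) m (by simpa using hy) j).comp_injective
        (node_injective j)
      simpa [tailTerm, Function.comp_def] using this)
  simp only [green_mul_tail] at h
  refine ⟨h.1, ?_⟩
  rw [solution, if_pos hj]
  simpa [tailTerm] using h.2

/-- The weighted bound for the coordinates of the solution. -/
lemma rpow_mul_solution_le_tail (S : GapModel u₀ π P u) {y : ℤ → ℂ} {τ : ℝ} (hτ : 0 ≤ τ)
    (hy : FiniteEnergy P (τ + |m| / 2 + 2) y) {j : ℤ} (hj : j ∈ P.weights) {W : ℝ} (hW : 0 ≤ W)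
    (hWle : ∀ i, i ≠ 0 → W ≤ P.weight (node j i)) :
    W ^ τ * ‖solution P (ladder P u) m y j‖ ^ 2 ≤
      greenSumConst m (1 - u₀) * ∑' k, tailTerm P m τ y j k := by
  have hy0 : FiniteEnergy P (|m| / 2 + 2) y := S.finiteEnergy_mono (by linarith) hy
  have h := (S.summable_and_solution_bound hy0 hj).2
  have hK := greenSumConst_nonneg m (1 - u₀)
  have hs := (S.summable_tailTerm m hy j).comp_injective (node_injective j)
  have hs0 := (S.summable_tailTerm (τ := 0) m (by simpa using hy0) j).comp_injective
    (node_injective j)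
  -- The factor `W ^ τ` moves inside the sum because `W` lies below every weight that occurs. The
  -- node `i = 0` carries a zero term, so nothing is needed of the weight at `j` itself; the
  -- residual bound uses this with `W` larger than the weight at `j`.
  have hle : ∀ i, W ^ τ * tailTerm P m 0 y j (node j i) ≤ tailTerm P m τ y j (node j i) := by
    intro i
    unfold tailTerm
    rw [tail_node]
    split_ifs with hi
    · simp
    · have h1 := S.one_le (P.node_mem hj i)
      rw [Real.rpow_add (by linarith) τ, Real.rpow_add (by linarith) 0, Real.rpow_zero, one_mul]
      have h2 : W ^ τ ≤ P.weight (node j i) ^ τ := Real.rpow_le_rpow hW (hWle i hi) hτ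
      calc W ^ τ * (|(node j i : ℝ)| ^ (|m| + 3) * P.weight (node j i) ^ (1 / 2 : ℝ) *
              ‖y (node j i)‖ ^ 2)
          ≤ P.weight (node j i) ^ τ * (|(node j i : ℝ)| ^ (|m| + 3) *
              P.weight (node j i) ^ (1 / 2 : ℝ) * ‖y (node j i)‖ ^ 2) := by gcongr
        _ = _ := by ring
  calc W ^ τ * ‖solution P (ladder P u) m y j‖ ^ 2
      ≤ W ^ τ * (greenSumConst m (1 - u₀) * ∑' i, tailTerm P m 0 y j (node j i)) := by gcongr
    _ = greenSumConst m (1 - u₀) * ∑' i, W ^ τ * tailTerm P m 0 y j (node j i) := by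
        rw [tsum_mul_left]; ring
    _ ≤ greenSumConst m (1 - u₀) * ∑' i, tailTerm P m τ y j (node j i) := by
        refine mul_le_mul_of_nonneg_left ?_ hK
        exact (hs0.mul_left _).tsum_le_tsum hle hs
    _ ≤ _ := by
        refine mul_le_mul_of_nonneg_left ?_ hK
        exact tsum_comp_le_tsum_of_inj (S.summable_tailTerm m hy j)
          (S.tailTerm_nonneg hy.1 m τ j) (node_injective j)

lemma rpow_mul_solution_le (S : GapModel u₀ π P u) {y : ℤ → ℂ} {τ : ℝ} (hτ : 0 ≤ τ)
    (hy : FiniteEnergy P (τ + |m| / 2 + 2) y) {j : ℤ} (hj : j ∈ P.weights) {W : ℝ} (hW : 0 ≤ W)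
    (hWle : ∀ i, i ≠ 0 → W ≤ P.weight (node j i)) :
    W ^ τ * ‖solution P (ladder P u) m y j‖ ^ 2 ≤
      greenSumConst m (1 - u₀) * energy P (τ + |m| / 2 + 2) y :=
  (S.rpow_mul_solution_le_tail hτ hy hj hW hWle).trans
    (mul_le_mul_of_nonneg_left (S.tsum_tailTerm_le m hy j) (greenSumConst_nonneg _ _))

lemma weight_le_of_natAbs_le {j k : ℤ} (h : j.natAbs ≤ k.natAbs) : P.weight j ≤ P.weight k := by
  have h1 : (j : ℝ) ^ 2 ≤ (k : ℝ) ^ 2 := by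
    exact_mod_cast Int.natAbs_le_iff_sq_le.1 h
  unfold Series.weight
  linarith

lemma weight_le_node (j : ℤ) (i : ℕ) : P.weight j ≤ P.weight (node j i) :=
  weight_le_of_natAbs_le (by rw [natAbs_node]; omega)

/-- Outside the obstructions the coordinates of the solution satisfy the equation. -/
lemma residual_solution (S : GapModel u₀ π P u) {y : ℤ → ℂ}
    (hy : FiniteEnergy P (|m| / 2 + 2) y) {n : ℤ} (hn : n ∈ P.weights)
    (hno : n ∉ P.obstructions) :
    residual (ladder P u) m (solution P (ladder P u) m y) y n = 0 := by
  rcases Series.mem_of_notMem_obstructions hn hno with ⟨h0, h1⟩ | ⟨h0, h1⟩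
  · have h2 : n + 2 ∈ P.weights := P.add_two_mem hn (by omega)
    have s0 := (S.summable_and_solution_bound hy h1).1
    have s1 := (S.summable_and_solution_bound hy hn).1
    have s2 := (S.summable_and_solution_bound hy h2).1
    have ha1 : halfLine (ladder P u) n = fun l => halfLine (ladder P u) (n - 2) (l + 1) := by
      funext l
      rw [halfLine, halfLine, if_pos (by omega), if_pos h0]
      congr 1; push_cast; ring
    have ha2 : halfLine (ladder P u) (n + 2) = fun l => halfLine (ladder P u) (n - 2) (l + 2) := by
      funext l
      rw [halfLine, halfLine, if_pos (by omega), if_pos h0]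
      congr 1; push_cast; ring
    have hn1 : ∀ i, node n i = node (n - 2) (i + 1) := by
      intro i
      rw [node, node, if_pos (by omega), if_pos h0]; push_cast; ring
    have hn2 : ∀ i, node (n + 2) i = node (n - 2) (i + 2) := by
      intro i
      rw [node, node, if_pos (by omega), if_pos h0]; push_cast; ring
    simp only [ha1, hn1] at s1
    simp only [ha2, hn2] at s2
    have e := tsum_green_recurrence (S.halfLine_ne_zero h1) s0 s1 s2
    rw [residual, solution, solution, solution, if_pos h1, if_pos hn, if_pos h2]
    simp only [ha1, hn1, ha2, hn2]
    have e0 : halfLine (ladder P u) (n - 2) 0 = ladder P u (n - 2) := by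
      rw [halfLine, if_pos h0]; simp
    have e1 : halfLine (ladder P u) (n - 2) 1 = ladder P u n := by
      rw [halfLine, if_pos h0]; simp
    have e2 : node (n - 2) 1 = n := by rw [node, if_pos h0]; push_cast; ring
    rw [e0, e1, e2] at e
    linear_combination e / 2
  · have h2 : n - 2 ∈ P.weights := P.sub_two_mem hn (by omega)
    have s0 := (S.summable_and_solution_bound hy h1).1
    have s1 := (S.summable_and_solution_bound hy hn).1
    have s2 := (S.summable_and_solution_bound hy h2).1
    have ha1 : halfLine (ladder P u) n = fun l => halfLine (ladder P u) (n + 2) (l + 1) := by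
      funext l
      rw [halfLine, halfLine, if_neg (by omega), if_neg (by omega)]
      congr 3; push_cast; ring
    have ha2 : halfLine (ladder P u) (n - 2) = fun l => halfLine (ladder P u) (n + 2) (l + 2) := by
      funext l
      rw [halfLine, halfLine, if_neg (by omega), if_neg (by omega)]
      congr 3; push_cast; ring
    have hn1 : ∀ i, node n i = node (n + 2) (i + 1) := by
      intro i
      rw [node, node, if_neg (by omega), if_neg (by omega)]; push_cast; ring
    have hn2 : ∀ i, node (n - 2) i = node (n + 2) (i + 2) := by
      intro i
      rw [node, node, if_neg (by omega), if_neg (by omega)]; push_cast; ring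
    simp only [ha1, hn1] at s1
    simp only [ha2, hn2] at s2
    have e := tsum_green_recurrence (S.halfLine_ne_zero h1) s0 s1 s2
    rw [residual, solution, solution, solution, if_pos h1, if_pos hn, if_pos h2]
    simp only [ha1, hn1, ha2, hn2]
    have e0 : halfLine (ladder P u) (n + 2) 0 = -conj (ladder P u n) := by
      rw [halfLine, if_neg (by omega)]; simp
    have e1 : halfLine (ladder P u) (n + 2) 1 = -conj (ladder P u (n - 2)) := by
      rw [halfLine, if_neg (by omega)]; simp
    have e2 : node (n + 2) 1 = n := by rw [node, if_neg (by omega)]; push_cast; ring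
    rw [e0, e1, e2, map_neg, Complex.conj_conj] at e
    linear_combination e / 2

/-- The bound for the residual of the solution. -/
lemma rpow_mul_residual_le (S : GapModel u₀ π P u) {y : ℤ → ℂ} {t : ℝ} (ht : 0 ≤ t)
    (hy : FiniteEnergy P (t + |m| / 2 + 3) y) {n : ℤ} (hn : n ∈ P.weights) :
    √(P.weight n ^ t) * ‖residual (ladder P u) m (solution P (ladder P u) m y) y n‖ ≤
      ((1 + |m|) * √(greenSumConst m (1 - u₀)) + 1) * √(energy P (t + |m| / 2 + 3) y) := by
  have hm0 := abs_nonneg m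
  set E := energy P (t + |m| / 2 + 3) y with hE
  set K := greenSumConst m (1 - u₀) with hK
  have hK0 : 0 ≤ K := greenSumConst_nonneg _ _
  set F := solution P (ladder P u) m y with hF
  set w := P.weight n with hw
  have hw1 : 1 ≤ w := S.one_le hn
  have hE0 : 0 ≤ E := S.energy_nonneg hy.1 _
  -- The order `t + 1` leaves a spare `√w` for the ladder coefficients. For each of the three `j`,
  -- all nodes with `i ≥ 1` have modulus at least `|n|`, even if `j` is closer to zero than `n`.
  have key : ∀ j : ℤ, (j = n - 2 ∨ j = n ∨ j = n + 2) →
      √(w ^ t) * (w ^ (1 / 2 : ℝ) * ‖F j‖) ≤ √K * √E := by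
    intro j hj
    by_cases hjw : j ∈ P.weights
    · have h := S.rpow_mul_solution_le (m := m) (τ := t + 1) (by linarith)
        (by convert hy using 1; ring) hjw (W := w) (by linarith) (fun i hi => by
          apply weight_le_of_natAbs_le
          unfold node
          split_ifs <;> omega)
      have e : t + 1 + |m| / 2 + 2 = t + |m| / 2 + 3 := by ring
      rw [e] at h
      rw [← Real.sqrt_mul hK0]
      refine Real.le_sqrt_of_sq_le (le_trans (le_of_eq ?_) h)
      rw [mul_pow, mul_pow, Real.sq_sqrt (by positivity), ← Real.sqrt_eq_rpow,
        Real.sq_sqrt (by positivity), Real.rpow_add_one (by positivity)]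
      ring
    · have : F j = 0 := by rw [hF, solution, if_neg hjw]
      rw [this]
      simp only [norm_zero, mul_zero]
      positivity
  obtain ⟨ha1, ha2⟩ := S.basis.norm_ladder_le S.pos S.lt_one S.gap hn
  have hy1 : √(w ^ t) * ‖y n‖ ≤ √E := by
    refine Real.le_sqrt_of_sq_le ?_
    rw [mul_pow, Real.sq_sqrt (by positivity)]
    refine (S.term_mono hy.1 (by linarith : t ≤ t + |m| / 2 + 3) n).trans ?_
    exact hy.2.le_tsum n fun k _ => S.term_nonneg hy.1 _ k
  have k1 := key (n - 2) (by simp)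
  have k2 := key n (by simp)
  have k3 := key (n + 2) (by simp)
  have hw2 : 1 ≤ w ^ (1 / 2 : ℝ) := Real.one_le_rpow hw1 (by norm_num)
  have hr : ‖residual (ladder P u) m F y n‖ ≤
      (1 / 2) * (w ^ (1 / 2 : ℝ) * ‖F (n - 2)‖ + 2 * |m| * (w ^ (1 / 2 : ℝ) * ‖F n‖)
        + w ^ (1 / 2 : ℝ) * ‖F (n + 2)‖) + ‖y n‖ := by
    unfold residual
    refine (norm_sub_le _ _).trans (add_le_add_left ?_ _)
    rw [norm_mul]
    have e : ‖(1 / 2 : ℂ)‖ = 1 / 2 := by norm_num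
    rw [e]
    refine mul_le_mul_of_nonneg_left ?_ (by norm_num)
    refine (norm_sub_le _ _).trans (add_le_add ((norm_add_le _ _).trans (add_le_add ?_ ?_)) ?_)
    · rw [norm_mul]; gcongr
    · rw [norm_mul, norm_mul, Complex.norm_real, Complex.norm_ofNat, Real.norm_eq_abs]
      gcongr
      exact le_mul_of_one_le_left (norm_nonneg _) hw2
    · rw [norm_mul, RCLike.norm_conj]; gcongr
  calc √(w ^ t) * ‖residual (ladder P u) m F y n‖
      ≤ √(w ^ t) * ((1 / 2) * (w ^ (1 / 2 : ℝ) * ‖F (n - 2)‖ + 2 * |m| *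
        (w ^ (1 / 2 : ℝ) * ‖F n‖) + w ^ (1 / 2 : ℝ) * ‖F (n + 2)‖) + ‖y n‖) := by gcongr
    _ = (1 / 2) * (√(w ^ t) * (w ^ (1 / 2 : ℝ) * ‖F (n - 2)‖)) +
        |m| * (√(w ^ t) * (w ^ (1 / 2 : ℝ) * ‖F n‖)) +
        (1 / 2) * (√(w ^ t) * (w ^ (1 / 2 : ℝ) * ‖F (n + 2)‖)) + √(w ^ t) * ‖y n‖ := by ring
    _ ≤ (1 / 2) * (√K * √E) + |m| * (√K * √E) + (1 / 2) * (√K * √E) + √E := by gcongr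
    _ = _ := by ring

/-- Sufficiently regular solutions of the equation are given by `solution`. -/
lemma solution_eq (S : GapModel u₀ π P u) {x y : ℤ → ℂ}
    (hx : FiniteEnergy P (|m| / 2 + 2) x) (hy : FiniteEnergy P (|m| / 2 + 2) y)
    (heq : ∀ k, ladder P u (k - 2) * x (k - 2) + 2 * m * x k
      - conj (ladder P u k) * x (k + 2) = 2 * y k) (j : ℤ) :
    solution P (ladder P u) m y j = x j := by
  by_cases hj : j ∈ P.weights
  swap
  · rw [solution, if_neg hj, hx.1 j hj]
  rw [solution, if_pos hj]
  set a := halfLine (ladder P u) j with ha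
  have hm0 := abs_nonneg m
  -- Along the half-line the equation takes the form required by `sum_green_mul`; downwards, the
  -- sign and conjugation in `halfLine` exchange the roles of the two neighbours.
  have hrec : ∀ i, a i * x (node j i) + 2 * m * x (node j (i + 1))
      - conj (a (i + 1)) * x (node j (i + 2)) = 2 * y (node j (i + 1)) := by
    intro i
    have h := heq (node j (i + 1))
    simp only [ha, halfLine, node] at h ⊢
    split_ifs at h ⊢ with h0
    · have e1 : j + 2 * ((i + 1 : ℕ) : ℤ) - 2 = j + 2 * i := by push_cast; ring
      have e2 : j + 2 * ((i + 1 : ℕ) : ℤ) + 2 = j + 2 * ((i + 2 : ℕ) : ℤ) := by push_cast; ring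
      rwa [e1, e2] at h
    · have e1 : j - 2 * ((i + 1 : ℕ) : ℤ) + 2 = j - 2 * i := by push_cast; ring
      have e2 : j - 2 * ((i + 1 : ℕ) : ℤ) - 2 = j - 2 * ((i + 2 : ℕ) : ℤ) := by push_cast; ring
      have e3 : j - 2 * (i : ℤ) - 2 = j - 2 * ((i + 1 : ℕ) : ℤ) := by push_cast; ring
      rw [e1, e2] at h
      rw [e2, e3, map_neg, Complex.conj_conj]
      linear_combination h
  have hsum := fun n => sum_green_mul (m := m) (a := a) (b := fun i => x (node j i))
    (h := fun i => y (node j i)) (S.halfLine_ne_zero hj) hrec n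
  have hG := norm_green_le (m := m) (sub_pos.2 S.lt_one) (S.le_norm_halfLine hj)
    (S.norm_halfLine_mono hj)
  rw [← ha] at hG
  set K := greenConst m (1 - u₀) with hK
  have hK0 : 0 ≤ K := (greenConst_pos m (sub_pos.2 S.lt_one)).le
  have hdecay : Filter.Tendsto
      (fun i : ℕ => P.weight (node j i) ^ (|m| / 2 + 2) * ‖x (node j i)‖ ^ 2)
      Filter.atTop (nhds 0) :=
    (hx.2.comp_injective (node_injective j)).tendsto_atTop_zero
  -- The boundary terms of the summation by parts: the squared coefficient costs one power of the
  -- weight and the squared Green's function `|m| / 2 + 1`, in total the exponent `|m| / 2 + 2` of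
  -- the assumed energy. The power of `2` comes from `(q + 1)² ≤ 2 (1 + q²)`.
  have hbound : ∀ (c : ℂ) (p q : ℕ), p ≤ q + 1 → ‖c‖ ^ 2 ≤ P.weight (node j q) →
      ‖c * green m a p * x (node j q)‖ ^ 2 ≤ K ^ 2 * 2 ^ (|m| / 2 + 1) *
        (P.weight (node j q) ^ (|m| / 2 + 2) * ‖x (node j q)‖ ^ 2) := by
    intro c p q hpq hc
    have hw := S.sq_le_weight_node hj q
    set w := P.weight (node j q) with hw'
    have hw0 : 0 < w := by nlinarith
    have hp : (p : ℝ) ^ 2 ≤ 2 * w := by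
      have h1 : (p : ℝ) ≤ q + 1 := by exact_mod_cast hpq
      have h2 : (0 : ℝ) ≤ p := by positivity
      nlinarith [sq_nonneg ((q : ℝ) - 1)]
    have hg : ‖green m a p‖ ^ 2 ≤ K ^ 2 * (2 ^ (|m| / 2 + 1) * w ^ (|m| / 2 + 1)) := by
      refine (pow_le_pow_left₀ (norm_nonneg _) (hG p) 2).trans ?_
      rw [mul_pow]
      gcongr
      rw [← Real.mul_rpow (by norm_num) hw0.le, ← Real.rpow_natCast, ← Real.rpow_mul
        (by positivity), mul_comm, Real.rpow_mul (by positivity), Real.rpow_natCast]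
      gcongr
    have e : w ^ (|m| / 2 + 2) = w * w ^ (|m| / 2 + 1) := by
      rw [mul_comm, ← Real.rpow_add_one hw0.ne']
      congr 1; ring
    rw [norm_mul, norm_mul, mul_pow, mul_pow, e]
    calc ‖c‖ ^ 2 * ‖green m a p‖ ^ 2 * ‖x (node j q)‖ ^ 2
        ≤ w * (K ^ 2 * (2 ^ (|m| / 2 + 1) * w ^ (|m| / 2 + 1))) * ‖x (node j q)‖ ^ 2 := by gcongr
      _ = _ := by ring
  have hlim : ∀ (c : ℕ → ℂ) (p q : ℕ → ℕ), (∀ n, p n ≤ q n + 1) →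
      (∀ n, ‖c n‖ ^ 2 ≤ P.weight (node j (q n))) → Filter.Tendsto q Filter.atTop Filter.atTop →
      Filter.Tendsto (fun n => c n * green m a (p n) * x (node j (q n))) Filter.atTop
        (nhds 0) := by
    intro c p q hpq hc hq
    have h1 := (hdecay.comp hq).const_mul (K ^ 2 * 2 ^ (|m| / 2 + 1))
    rw [mul_zero] at h1
    have h2 : Filter.Tendsto (fun n => ‖c n * green m a (p n) * x (node j (q n))‖ ^ 2)
        Filter.atTop (nhds 0) :=
      squeeze_zero (fun _ => sq_nonneg _) (fun n => hbound _ _ _ (hpq n) (hc n)) h1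
    have h3 := h2.sqrt
    simp only [Real.sqrt_sq (norm_nonneg _), Real.sqrt_zero] at h3
    exact tendsto_zero_iff_norm_tendsto_zero.2 h3
  have l1 := hlim a (fun n => n + 1) (fun n => n) (fun n => le_rfl)
    (fun n => (S.norm_halfLine_sq_le hj n).1) Filter.tendsto_id
  have l2 := hlim (fun n => conj (a n)) (fun n => n) (fun n => n + 1) (fun n => by omega)
    (fun n => by rw [RCLike.norm_conj]; exact (S.norm_halfLine_sq_le hj n).2)
    (Filter.tendsto_add_atTop_nat 1)
  have l3 := (((S.summable_and_solution_bound hy hj).1.hasSum.tendsto_sum_nat.comp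
    (Filter.tendsto_add_atTop_nat 1)).const_mul 2)
  have l4 := ((tendsto_const_nhds (x := 2 * x (node j 0))).sub l1).sub l2
  have e := tendsto_nhds_unique (l3.congr fun n => hsum n) l4
  have e0 : node j 0 = j := by simp [node]
  rw [e0] at e
  linear_combination e / 2

end GapModel

end Solution

end TwistedSL2

/-! ### Invariant distributions, synthesis of the solution and Sobolev estimates -/

namespace TwistedSL2

open scoped ComplexConjugate

lemma solution_smul {P : Series} (A : ℤ → ℂ) (m : ℝ) (c : ℂ) (y : ℤ → ℂ) (j : ℤ) :
    solution P A m (fun k => c * y k) j = c * solution P A m y j := by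
  unfold solution
  split_ifs with hj
  · rw [← tsum_mul_left]
    congr 1
    funext i
    ring
  · simp

section Synthesis

variable {H : Type*} [NormedAddCommGroup H] [InnerProductSpace ℂ H]

lemma summable_one_div_one_add_sq : Summable fun k : ℤ => 1 / (1 + (k : ℝ) ^ 2) := by
  have h : Summable fun k : ℤ => 1 / (k : ℝ) ^ 2 := Real.summable_one_div_int_pow.2 one_lt_two
  refine Summable.of_norm_bounded_eventually h ?_
  have : ({0} : Set ℤ)ᶜ ∈ (Filter.cofinite : Filter ℤ) := (Set.finite_singleton 0).compl_mem_cofinite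
  filter_upwards [this] with k hk
  have hk0 : (k : ℝ) ≠ 0 := by exact_mod_cast hk
  rw [Real.norm_of_nonneg (by positivity)]
  gcongr
  linarith

namespace GapModel

variable {u₀ : ℝ} {π : UnitaryRep H} {P : Series} {u : ℤ → H} {m : ℝ}

lemma finiteEnergy_coord_iff (S : GapModel u₀ π P u) {s : ℝ} {v : H} :
    FiniteEnergy P s (coord u v) ↔ v ∈ sobolev P u s := by
  have h0 : ∀ k, k ∉ P.weights → coord u v k = 0 := fun k hk => S.basis.coord_eq_zero hk v
  change _ ↔ Summable fun k => |sobolevTerm P u s (coeff u v) k|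
  simp only [sobolevTerm_coeff, abs_of_nonneg (S.term_nonneg h0 s _)]
  exact ⟨fun h => h.2, fun h => ⟨h0, h⟩⟩

lemma sobolevNorm_eq (s : ℝ) (v : H) :
    sobolevNorm P u s v = √(energy P s (coord u v)) := by
  simp only [sobolevNorm, seriesNorm, sobolevTerm_coeff, energy]

lemma seriesNorm_thetaPow (τ : ℝ) (v : H) (j : ℤ) :
    seriesNorm P u (τ + 1 / 2) (thetaPow ((|m| + 3) / 2) (tail (tailStart j) (coeff u v))) =
      √(∑' k, tailTerm P m τ (coord u v) j k) := by
  unfold seriesNorm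
  congr 2
  funext k
  have e : ‖tail (tailStart j) (coord u v) k‖ = ‖u k‖ * ‖tail (tailStart j) (coeff u v) k‖ := by
    unfold tail
    split_ifs
    · rw [coord_eq, norm_mul, Complex.norm_real, norm_norm]
    · simp
  -- No tail contains the weight `0`, so the value of the complex power of `0` is irrelevant.
  rcases eq_or_ne k 0 with rfl | hk
  · have : ∀ y : ℤ → ℂ, tail (tailStart j) y 0 = 0 := by
      intro y
      unfold tail tailStart
      split_ifs <;> first | rfl | omega
    simp [sobolevTerm, tailTerm, thetaPow, this]
  · have hk0 : (0 : ℝ) < |(k : ℝ)| := by positivity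
    have h1 : ‖(Complex.I * k) ^ (((|m| + 3) / 2 : ℝ) : ℂ)‖ ^ 2 = |(k : ℝ)| ^ (|m| + 3) := by
      rw [Complex.norm_cpow_real, norm_mul, Complex.norm_I, one_mul, Complex.norm_intCast,
        ← Real.rpow_natCast, ← Real.rpow_mul hk0.le]
      congr 1
      push_cast
      ring
    rw [sobolevTerm, tailTerm, thetaPow, norm_mul, mul_pow, h1, e, Series.weight]
    ring

lemma coord_smul_basis (S : GapModel u₀ π P u) (c : ℂ) (n k : ℤ) :
    coord u (c • u n) k = if k = n then c * ‖u n‖ else 0 := by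
  split_ifs with h
  · subst h
    by_cases hk : k ∈ P.weights
    · rw [coord, inner_smul_right, ← smul_unitVec u k, inner_smul_right,
        S.basis.inner_unitVec_self S.pos S.lt_one S.gap hk, smul_unitVec, mul_one]
    · rw [S.basis.coord_eq_zero hk, S.basis.eq_zero k hk]
      simp
  · rw [coord, inner_smul_right, ← smul_unitVec u n, inner_smul_right,
      S.basis.inner_unitVec_of_ne h, mul_zero, mul_zero]

lemma sobolevNorm_smul_basis (S : GapModel u₀ π P u) (t : ℝ) (c : ℂ) {n : ℤ}
    (hn : n ∈ P.weights) :
    sobolevNorm P u t (c • u n) = √(P.weight n ^ t) * ‖c * ‖u n‖‖ := by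
  have h1 := S.one_le hn
  rw [sobolevNorm_eq, energy, tsum_eq_single n]
  · rw [S.coord_smul_basis, if_pos rfl, Real.sqrt_mul (by positivity),
      Real.sqrt_sq (norm_nonneg _)]
  · intro k hk
    rw [S.coord_smul_basis, if_neg hk]
    simp

/-- A sequence of coordinates with enough decay defines a vector in the domain of `X`. -/
lemma exists_derives [CompleteSpace H] (S : GapModel u₀ π P u) {F : ℤ → ℂ}
    (hF : ∀ k, k ∉ P.weights → F k = 0)
    (hs : Summable fun k => P.weight k ^ (1 / 2 : ℝ) * ‖F k‖) :
    ∃ f w : H, Derives π expX f w ∧ ∀ k, coord u f k = F k := by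
  have hv : ∀ k, ‖F k • unitVec u k‖ ≤ P.weight k ^ (1 / 2 : ℝ) * ‖F k‖ := by
    intro k
    by_cases hk : k ∈ P.weights
    · rw [norm_smul, mul_comm]
      gcongr
      exact (IsAdaptedBasis.norm_unitVec_le k).trans
        (Real.one_le_rpow (S.one_le hk) (by norm_num))
    · simp [hF k hk]
  have hw : ∀ k, ‖F k • ((1 / 2 : ℂ) • (ladder P u k • unitVec u (k + 2)
      - conj (ladder P u (k - 2)) • unitVec u (k - 2)))‖ ≤ P.weight k ^ (1 / 2 : ℝ) * ‖F k‖ := by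
    intro k
    by_cases hk : k ∈ P.weights
    · rw [norm_smul, mul_comm]
      gcongr
      obtain ⟨h1, h2⟩ := S.basis.norm_ladder_le S.pos S.lt_one S.gap hk
      have h3 : ‖ladder P u k • unitVec u (k + 2)‖ ≤ P.weight k ^ (1 / 2 : ℝ) := by
        rw [norm_smul]
        exact (mul_le_of_le_one_right (norm_nonneg _)
          (IsAdaptedBasis.norm_unitVec_le _)).trans h1
      have h4 : ‖conj (ladder P u (k - 2)) • unitVec u (k - 2)‖ ≤ P.weight k ^ (1 / 2 : ℝ) := by
        rw [norm_smul, RCLike.norm_conj]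
        exact (mul_le_of_le_one_right (norm_nonneg _)
          (IsAdaptedBasis.norm_unitVec_le _)).trans h2
      rw [norm_smul]
      have h5 := norm_sub_le (ladder P u k • unitVec u (k + 2))
        (conj (ladder P u (k - 2)) • unitVec u (k - 2))
      have e : ‖(1 / 2 : ℂ)‖ = 1 / 2 := by norm_num
      rw [e]
      linarith
    · simp [hF k hk]
  have sv : Summable fun k => F k • unitVec u k := Summable.of_norm_bounded hs hv
  have sw := Summable.of_norm_bounded hs hw
  refine ⟨_, _, Derives.of_hasSum (fun k =>
    (S.basis.derives_unitVec S.pos S.lt_one S.gap k).smul (F k)) sv.hasSum sw.hasSum, fun k => ?_⟩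
  have h := (innerSL ℂ (unitVec u k)).map_tsum sv
  simp only [innerSL_apply_apply, inner_smul_right] at h
  rw [coord, h, tsum_eq_single k]
  · by_cases hk : k ∈ P.weights
    · rw [S.basis.inner_unitVec_self S.pos S.lt_one S.gap hk, mul_one]
    · rw [hF k hk, zero_mul]
  · intro j hj
    rw [S.basis.inner_unitVec_of_ne hj.symm, mul_zero]

lemma coord_solvesTwisted (S : GapModel u₀ π P u) {f g : H} (h : SolvesTwisted π m f g) (k : ℤ) :
    ladder P u (k - 2) * coord u f (k - 2) + 2 * m * coord u f k
      - conj (ladder P u k) * coord u f (k + 2) = 2 * coord u g k := by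
  obtain ⟨w, hw, rfl⟩ := h
  have h1 := S.basis.coord_derives S.pos S.lt_one S.gap hw k
  have h2 : coord u (w + (m : ℂ) • f) k = coord u w k + m * coord u f k := by
    simp only [coord, inner_add_right, inner_smul_right]
  rw [h2]
  linear_combination -h1

/-- By uniqueness the coordinates of `f` are those given by `solution`, and they satisfy the
equation at every `n`, also at the obstructions. -/
lemma residual_eq_zero_of_solvesTwisted (S : GapModel u₀ π P u) {f g : H}
    (hf : FiniteEnergy P (|m| / 2 + 2) (coord u f)) (hg : FiniteEnergy P (|m| / 2 + 2) (coord u g))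
    (h : SolvesTwisted π m f g) (n : ℤ) :
    residual (ladder P u) m (solution P (ladder P u) m (coord u g)) (coord u g) n = 0 := by
  have h1 := S.coord_solvesTwisted h
  have h2 := S.solution_eq hf hg h1
  rw [residual, h2, h2, h2]
  linear_combination h1 n / 2

lemma solution_add (S : GapModel u₀ π P u) {y y' : ℤ → ℂ} (hy : FiniteEnergy P (|m| / 2 + 2) y)
    (hy' : FiniteEnergy P (|m| / 2 + 2) y') (j : ℤ) :
    solution P (ladder P u) m (fun k => y k + y' k) j =
      solution P (ladder P u) m y j + solution P (ladder P u) m y' j := by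
  unfold solution
  split_ifs with hj
  · rw [← (S.summable_and_solution_bound hy hj).1.tsum_add
      (S.summable_and_solution_bound hy' hj).1]
    simp only [mul_add]
  · simp

lemma finiteEnergy_coe (S : GapModel u₀ π P u) (m : ℝ) (g : sobolev P u ((|m| + 8) / 2)) :
    FiniteEnergy P (|m| / 2 + 4) (coord u (g : H)) := by
  have h := S.finiteEnergy_coord_iff.2 g.2
  convert h using 1
  ring

/-- The invariant distributions. -/
noncomputable def distribution (S : GapModel u₀ π P u) (m : ℝ) (n : ℤ) :
    sobolev P u ((|m| + 8) / 2) →ₗ[ℂ] ℂ where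
  toFun g := residual (ladder P u) m (solution P (ladder P u) m (coord u (g : H)))
    (coord u (g : H)) n / ‖u n‖
  map_add' g g' := by
    have hc : coord u ((g + g' : sobolev P u ((|m| + 8) / 2)) : H) =
        fun k => coord u (g : H) k + coord u (g' : H) k := by
      funext k
      simp [coord]
    have hg := S.finiteEnergy_mono (s' := |m| / 2 + 2) (by linarith) (S.finiteEnergy_coe m g)
    have hg' := S.finiteEnergy_mono (s' := |m| / 2 + 2) (by linarith) (S.finiteEnergy_coe m g')
    rw [hc]
    simp only [residual, S.solution_add hg hg']
    ring
  map_smul' c g := by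
    have hc : coord u ((c • g : sobolev P u ((|m| + 8) / 2)) : H) =
        fun k => c * coord u (g : H) k := by
      funext k
      simp [coord]
    rw [hc]
    simp only [residual, solution_smul, RingHom.id_apply, smul_eq_mul]
    ring

lemma distribution_mul_norm (S : GapModel u₀ π P u) (g : sobolev P u ((|m| + 8) / 2)) {n : ℤ}
    (hn : n ∈ P.weights) :
    S.distribution m n g * ‖u n‖ = residual (ladder P u) m
      (solution P (ladder P u) m (coord u (g : H))) (coord u (g : H)) n := by
  have h1 : (‖u n‖ : ℂ) ≠ 0 := by
    exact_mod_cast (S.basis.norm_pos S.pos S.lt_one S.gap hn).ne'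
  exact div_mul_cancel₀ _ h1

/-- The constant in the estimates for the solution and the distributions. -/
noncomputable def const (m u₀ : ℝ) : ℝ :=
  1 + √(greenSumConst m (1 - u₀)) * √(∑' k : ℤ, 1 / (1 + (k : ℝ) ^ 2))
    + (1 + |m|) * √(greenSumConst m (1 - u₀))

lemma const_pos (m u₀ : ℝ) : 0 < const m u₀ := by
  unfold const
  positivity

lemma sobolevNorm_distribution_smul_le (S : GapModel u₀ π P u) {t : ℝ} (ht : 0 ≤ t)
    (g : sobolev P u ((|m| + 8) / 2)) (hg : (g : H) ∈ sobolev P u ((|m| + 8) / 2 + t)) {n : ℤ}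
    (hn : n ∈ P.weights) :
    sobolevNorm P u t (S.distribution m n g • u n) ≤
      const m u₀ * sobolevNorm P u ((|m| + 8) / 2 + t) (g : H) := by
  have hfin := S.finiteEnergy_coord_iff.2 hg
  have hle : t + |m| / 2 + 3 ≤ (|m| + 8) / 2 + t := by linarith
  rw [S.sobolevNorm_smul_basis t _ hn, S.distribution_mul_norm g hn, sobolevNorm_eq]
  refine (S.rpow_mul_residual_le ht (S.finiteEnergy_mono hle hfin) hn).trans ?_
  refine mul_le_mul ?_ (Real.sqrt_le_sqrt (S.energy_mono hle hfin)) (Real.sqrt_nonneg _)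
    (const_pos _ _).le
  unfold const
  have : 0 ≤ √(greenSumConst m (1 - u₀)) * √(∑' k : ℤ, 1 / (1 + (k : ℝ) ^ 2)) := by positivity
  linarith

/-- Boundedness is the case `t = 0` of the tame estimate; invariance holds because smooth vectors
are regular enough for the uniqueness of solutions. -/
lemma isInvariantDistribution (S : GapModel u₀ π P u) {n : ℤ} (hn : n ∈ P.weights) :
    IsInvariantDistribution π P u m ((|m| + 8) / 2) (S.distribution m n) := by
  have hpos := S.basis.norm_pos S.pos S.lt_one S.gap hn
  refine ⟨⟨const m u₀ / ‖u n‖, fun g => ?_⟩, fun φ hφ h hsol => ?_⟩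
  · have h := S.sobolevNorm_distribution_smul_le le_rfl g (by simp) hn
    rw [S.sobolevNorm_smul_basis 0 _ hn, Real.rpow_zero, Real.sqrt_one, one_mul, norm_mul,
      Complex.norm_real, norm_norm, add_zero] at h
    rw [div_mul_eq_mul_div, le_div_iff₀ hpos]
    exact h
  · have h1 := S.residual_eq_zero_of_solvesTwisted (m := m)
      (S.finiteEnergy_coord_iff.2 (hφ (|m| / 2 + 2) (by positivity)))
      (S.finiteEnergy_mono (by linarith) (S.finiteEnergy_coe m h)) hsol n
    have h2 := S.distribution_mul_norm h hn
    rw [h1] at h2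
    exact (mul_eq_zero.1 h2).resolve_right (by exact_mod_cast hpos.ne')

/-- The energy of the solution. -/
lemma energy_solution (S : GapModel u₀ π P u) {y : ℤ → ℂ} {t : ℝ} (ht : 0 ≤ t)
    (hy : FiniteEnergy P (t + |m| / 2 + 3) y) :
    FiniteEnergy P t (solution P (ladder P u) m y) ∧
      energy P t (solution P (ladder P u) m y) ≤
        greenSumConst m (1 - u₀) * (∑' k : ℤ, 1 / (1 + (k : ℝ) ^ 2)) *
          energy P (t + |m| / 2 + 3) y := by
  set E := energy P (t + |m| / 2 + 3) y with hE
  set K := greenSumConst m (1 - u₀) with hK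
  have hK0 : 0 ≤ K := greenSumConst_nonneg _ _
  have hE0 : 0 ≤ E := S.energy_nonneg hy.1 _
  have h0 : ∀ k, k ∉ P.weights → solution P (ladder P u) m y k = 0 := fun k hk => by
    rw [solution, if_neg hk]
  -- The coordinate bound at order `t + 1` has one weight to spare; it is at least `1 + k²` and
  -- makes the sum over `k` converge.
  have hle : ∀ k, P.weight k ^ t * ‖solution P (ladder P u) m y k‖ ^ 2 ≤
      K * E * (1 / (1 + (k : ℝ) ^ 2)) := by
    intro k
    by_cases hk : k ∈ P.weights
    · have h1 := S.one_le hk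
      have h2 := S.one_add_sq_le hk
      have h := S.rpow_mul_solution_le (m := m) (τ := t + 1) (by linarith)
        (by convert hy using 1; ring) hk (W := P.weight k) (by linarith)
        (fun i _ => weight_le_node k i)
      have e : t + 1 + |m| / 2 + 2 = t + |m| / 2 + 3 := by ring
      rw [e, Real.rpow_add_one (by positivity)] at h
      rw [mul_one_div, le_div_iff₀ (by positivity)]
      calc P.weight k ^ t * ‖solution P (ladder P u) m y k‖ ^ 2 * (1 + (k : ℝ) ^ 2)
          ≤ P.weight k ^ t * ‖solution P (ladder P u) m y k‖ ^ 2 * P.weight k := by gcongr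
        _ = P.weight k ^ t * P.weight k * ‖solution P (ladder P u) m y k‖ ^ 2 := by ring
        _ ≤ _ := h
    · rw [h0 k hk]
      simp only [norm_zero, ne_eq, OfNat.ofNat_ne_zero, not_false_eq_true, zero_pow, mul_zero]
      positivity
  have hs := summable_one_div_one_add_sq.mul_left (K * E)
  have hf : FiniteEnergy P t (solution P (ladder P u) m y) :=
    ⟨h0, Summable.of_nonneg_of_le (S.term_nonneg h0 t) hle hs⟩
  refine ⟨hf, (hf.2.tsum_le_tsum hle hs).trans (le_of_eq ?_)⟩
  rw [tsum_mul_left]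
  ring

/-- The equation `(X + m) f = g`, corrected by the invariant distributions, is solvable. -/
lemma exists_solvesTwisted [CompleteSpace H] (S : GapModel u₀ π P u)
    (g : sobolev P u ((|m| + 8) / 2)) (hg : FiniteEnergy P (|m| / 2 + 8) (coord u (g : H))) :
    ∃ f : H, coord u f = solution P (ladder P u) m (coord u (g : H)) ∧
      SolvesTwisted π m f (g + ∑ n ∈ P.obstructions, S.distribution m n g • u n) := by
  set F := solution P (ladder P u) m (coord u (g : H)) with hF
  -- The regularity `|m| / 2 + 8` of `g` leaves order `5` for the solution, more than enough for the
  -- absolute convergence of the series and of its termwise image under `X`.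
  obtain ⟨hF5, -⟩ := S.energy_solution (m := m) (t := 5) (by norm_num)
    (by convert hg using 1; ring)
  have hF0 : ∀ k, k ∉ P.weights → F k = 0 := hF5.1
  have hs : Summable fun k => P.weight k ^ (1 / 2 : ℝ) * ‖F k‖ := by
    refine Summable.of_nonneg_of_le (fun k => ?_) (fun k => ?_)
      (hF5.2.add summable_one_div_one_add_sq)
    · by_cases hk : k ∈ P.weights
      · have := S.one_le hk
        positivity
      · simp [hF0 k hk]
    · by_cases hk : k ∈ P.weights
      · have h1 := S.one_le hk
        have h2 := S.one_add_sq_le hk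
        set w := P.weight k
        have e1 : w ^ (5 : ℝ) = w ^ (1 / 2 : ℝ) * w ^ (1 / 2 : ℝ) * w ^ (4 : ℝ) := by
          rw [← Real.rpow_add (by linarith), ← Real.rpow_add (by linarith)]
          norm_num
        have e2 : w ≤ w ^ (4 : ℝ) := Real.self_le_rpow_of_one_le h1 (by norm_num)
        set q := w ^ (1 / 2 : ℝ)
        have h3 : 1 / w ≤ 1 / (1 + (k : ℝ) ^ 2) := by gcongr
        -- With `z = q ‖F k‖`, this is `z ≤ w z² + 1 / w`, which trades an `ℓ¹` bound for an `ℓ²`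
        -- bound and the summable `1 / w`.
        have h4 : q * ‖F k‖ ≤ w * (q * ‖F k‖) ^ 2 + 1 / w := by
          have hw0 : 0 < w := by linarith
          have hx : 0 ≤ (w * (q * ‖F k‖) - 1) ^ 2 := sq_nonneg _
          have hq : 0 ≤ q * ‖F k‖ := by positivity
          rw [← sub_nonneg]
          have e3 : w * (q * ‖F k‖) ^ 2 + 1 / w - q * ‖F k‖ =
              ((w * (q * ‖F k‖) - 1) ^ 2 + w * (q * ‖F k‖)) / w := by
            field_simp
            ring
          rw [e3]
          positivity
        calc q * ‖F k‖ ≤ w * (q * ‖F k‖) ^ 2 + 1 / w := h4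
          _ ≤ w ^ (4 : ℝ) * (q * ‖F k‖) ^ 2 + 1 / (1 + (k : ℝ) ^ 2) := by gcongr
          _ = _ := by rw [e1]; ring
      · have : 0 ≤ 1 / (1 + (k : ℝ) ^ 2) := by positivity
        rw [← hF, hF0 k hk]
        simpa only [norm_zero, mul_zero, ne_eq, OfNat.ofNat_ne_zero, not_false_eq_true, zero_pow,
          zero_add] using this
  obtain ⟨f, w, hfw, hcoord⟩ := S.exists_derives hF5.1 hs
  have hfF : coord u f = F := funext hcoord
  refine ⟨f, hfF, w, hfw, S.basis.ext_coord fun k => ?_⟩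
  have h1 := S.coord_solvesTwisted (m := m) ⟨w, hfw, rfl⟩ k
  have h2 : coord u ((g : H) + ∑ n ∈ P.obstructions, S.distribution m n g • u n) k =
      coord u (g : H) k + ∑ n ∈ P.obstructions, coord u (S.distribution m n g • u n) k := by
    simp only [coord, inner_add_right, inner_sum]
  have hr : residual (ladder P u) m F (coord u (g : H)) k + coord u (g : H) k =
      coord u (w + (m : ℂ) • f) k := by
    rw [residual, ← hfF]
    linear_combination h1 / 2
  rw [h2, ← hr, add_comm]
  congr 1
  simp only [S.coord_smul_basis]
  rw [Finset.sum_ite_eq]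
  -- At an obstruction the added multiple of `u k` is precisely the residual. Elsewhere the residual
  -- is zero, by the recurrence on one half-line or because `k` is not a weight.
  split_ifs with hk
  · rw [S.distribution_mul_norm g (Series.obstructions_subset hk)]
  · by_cases hkw : k ∈ P.weights
    · exact S.residual_solution (S.finiteEnergy_mono (by linarith) hg) hkw hk
    · rw [residual, hF0 k hkw, S.basis.coord_eq_zero hkw, S.basis.ladder_eq_zero (Or.inl hkw),
        S.basis.ladder_eq_zero (k := k - 2) (Or.inr (by rwa [sub_add_cancel]))]
      simp

lemma sobolevNorm_coeff_smul_le (S : GapModel u₀ π P u) {f g : H}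
    (hf : coord u f = solution P (ladder P u) m (coord u g)) {t : ℝ} (ht : 0 ≤ t)
    (hg : FiniteEnergy P (t + |m| / 2 + 3) (coord u g)) {n : ℤ} (hn : n ∈ P.weights) :
    sobolevNorm P u t (coeff u f n • u n) ≤ const m u₀ *
      seriesNorm P u (t + 1 / 2) (thetaPow ((|m| + 3) / 2) (tail (tailStart n) (coeff u g))) := by
  have h1 := S.one_le hn
  rw [S.sobolevNorm_smul_basis t _ hn, mul_comm (coeff u f n), ← coord_eq, hf,
    seriesNorm_thetaPow]
  have h := S.rpow_mul_solution_le_tail (m := m) ht (S.finiteEnergy_mono (by linarith) hg) hn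
    (W := P.weight n) (by linarith) (fun i _ => weight_le_node n i)
  have h2 : √(P.weight n ^ t) * ‖solution P (ladder P u) m (coord u g) n‖ ≤
      √(greenSumConst m (1 - u₀)) * √(∑' k, tailTerm P m t (coord u g) n k) := by
    rw [← Real.sqrt_mul (greenSumConst_nonneg _ _)]
    refine Real.le_sqrt_of_sq_le ?_
    rw [mul_pow, Real.sq_sqrt (by positivity)]
    exact h
  refine h2.trans (mul_le_mul_of_nonneg_right ?_ (Real.sqrt_nonneg _))
  unfold const
  have e1 : 0 ≤ √(greenSumConst m (1 - u₀)) * √(∑' k : ℤ, 1 / (1 + (k : ℝ) ^ 2)) := by positivity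
  have e2 : 0 ≤ |m| * √(greenSumConst m (1 - u₀)) := by positivity
  linarith

lemma sobolevNorm_solution_le (S : GapModel u₀ π P u) {f g : H}
    (hf : coord u f = solution P (ladder P u) m (coord u g)) {t : ℝ} (ht : 0 ≤ t)
    (hg : FiniteEnergy P (t + |m| / 2 + 3) (coord u g)) :
    sobolevNorm P u t f ≤ const m u₀ * sobolevNorm P u (t + |m| / 2 + 3) g := by
  have h := (S.energy_solution ht hg).2
  have hZ : 0 ≤ ∑' k : ℤ, 1 / (1 + (k : ℝ) ^ 2) := tsum_nonneg fun _ => by positivity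
  rw [sobolevNorm_eq, sobolevNorm_eq, hf]
  refine (Real.sqrt_le_sqrt h).trans ?_
  have hK := greenSumConst_nonneg m (1 - u₀)
  rw [Real.sqrt_mul (mul_nonneg hK hZ), Real.sqrt_mul hK]
  refine mul_le_mul_of_nonneg_right ?_ (Real.sqrt_nonneg _)
  unfold const
  have e2 : 0 ≤ (1 + |m|) * √(greenSumConst m (1 - u₀)) := by positivity
  linarith

end GapModel

end Synthesis

end TwistedSL2

theorem mainTheorem2 (u₀ : ℝ) (hu₀ : 0 < u₀) (hu₁ : u₀ < 1) (m : ℝ) (hm : m ≠ 0) :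
    ∃ C : ℝ, 0 < C ∧
      ∀ (H : Type*) [NormedAddCommGroup H] [InnerProductSpace ℂ H] [CompleteSpace H]
        (π : UnitaryRep H) (P : Series) (u : ℤ → H),
        P.HasGap u₀ → IsAdaptedBasis π P u →
        ∃ D : ℤ → (sobolev P u ((|m| + 8) / 2) →ₗ[ℂ] ℂ),
          (∀ n ∈ P.obstructions, IsInvariantDistribution π P u m ((|m| + 8) / 2) (D n)) ∧
          -- the equation with right-hand side corrected by the distributions
          (∀ s : ℝ, |m| / 2 + 8 ≤ s →
            ∀ g : sobolev P u ((|m| + 8) / 2), (g : H) ∈ sobolev P u s →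
              ∃ f ∈ sobolev P u (s - |m| / 2 - 3),
                SolvesTwisted π m f (g + ∑ n ∈ P.obstructions, D n g • u n) ∧
                (∀ t : ℝ, 0 ≤ t → t ≤ s - |m| / 2 - 3 →
                  sobolevNorm P u t f ≤ C * sobolevNorm P u (t + |m| / 2 + 3) g) ∧
                ∀ n ∈ P.weights, ∀ t : ℝ, 0 ≤ t → t ≤ s - |m| / 2 - 3 →
                  (n < 0 → sobolevNorm P u t (coeff u f n • u n) ≤
                    C * seriesNorm P u (t + 1 / 2)
                      (thetaPow ((|m| + 3) / 2) (tail (n - 2) (coeff u g)))) ∧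
                  (0 < n → sobolevNorm P u t (coeff u f n • u n) ≤
                    C * seriesNorm P u (t + 1 / 2)
                      (thetaPow ((|m| + 3) / 2) (tail (n + 2) (coeff u g))))) ∧
          -- the distributions vanish when there is a sufficiently regular solution
          (∀ s : ℝ, |m| / 2 + 8 ≤ s →
            ∀ g : sobolev P u ((|m| + 8) / 2), (g : H) ∈ sobolev P u s →
              ∀ f ∈ sobolev P u ((|m| + 10) / 2), SolvesTwisted π m f g →
                ∀ n ∈ P.obstructions, D n g = 0) ∧
          -- tame estimate for the distributions
          (∀ s : ℝ, (|m| + 8) / 2 ≤ s →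
            ∀ g : sobolev P u ((|m| + 8) / 2), (g : H) ∈ sobolev P u s →
              ∀ n ∈ P.obstructions, ∀ t : ℝ, 0 ≤ t → t ≤ s - (|m| + 8) / 2 →
                sobolevNorm P u t (D n g • u n) ≤
                  C * sobolevNorm P u ((|m| + 8) / 2 + t) g) := by
  -- The constant adds up the needs of the three estimates: `√K` for a single coordinate, `√K √(∑ 1
  -- / (1 + k²))` for the solution and `(1 + |m|) √K + 1` for the distributions, where `K =
  -- greenSumConst m (1 - u₀)`.
  refine ⟨GapModel.const m u₀, GapModel.const_pos m u₀, ?_⟩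
  intro H _ _ _ π P u hP hu
  have S : GapModel u₀ π P u := ⟨hu₀, hu₁, hP, hu⟩
  refine ⟨S.distribution m, fun n hn => S.isInvariantDistribution (Series.obstructions_subset hn),
    ?_, ?_, ?_⟩
  · intro s hs g hg
    have hfin := S.finiteEnergy_coord_iff.2 hg
    obtain ⟨f, hf, hsol⟩ := S.exists_solvesTwisted g (S.finiteEnergy_mono hs hfin)
    have hle : ∀ t : ℝ, t ≤ s - |m| / 2 - 3 →
        FiniteEnergy P (t + |m| / 2 + 3) (coord u (g : H)) := fun t ht =>
      S.finiteEnergy_mono (by linarith) hfin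
    refine ⟨f, ?_, hsol, fun t ht hts => S.sobolevNorm_solution_le hf ht (hle t hts), ?_⟩
    · rw [← S.finiteEnergy_coord_iff, hf]
      exact (S.energy_solution (by linarith) (hle _ le_rfl)).1
    · intro n hn t ht hts
      have h := S.sobolevNorm_coeff_smul_le hf ht (hle t hts) hn
      refine ⟨fun h0 => ?_, fun h0 => ?_⟩
      · rwa [tailStart, if_neg h0.not_gt] at h
      · rwa [tailStart, if_pos h0] at h
  · intro s hs g hg f hf hsol n hn
    have hn' := Series.obstructions_subset hn
    have h1 := S.residual_eq_zero_of_solvesTwisted (m := m)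
      (S.finiteEnergy_mono (by linarith) (S.finiteEnergy_coord_iff.2 hf))
      (S.finiteEnergy_mono (by linarith) (S.finiteEnergy_coe m g)) hsol n
    have h2 := S.distribution_mul_norm g hn'
    rw [h1] at h2
    have h3 := S.basis.norm_pos hu₀ hu₁ hP hn'
    exact (mul_eq_zero.1 h2).resolve_right (by exact_mod_cast h3.ne')
  · intro s hs g hg n hn t ht hts
    have hg' : (g : H) ∈ sobolev P u ((|m| + 8) / 2 + t) :=
      S.finiteEnergy_coord_iff.1
        (S.finiteEnergy_mono (by linarith) (S.finiteEnergy_coord_iff.2 hg))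
    exact S.sobolevNorm_distribution_smul_le ht g hg' (Series.obstructions_subset hn)
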